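/- Let $x,y\mapsto|\phi_{x,y}\rangle$ ($x\in\mathcal X$, $y\in\mathcal Y$) be a pure-state multiple access channel: each $|\phi_{x,y}\rangle$ is a unit vector of a complex Hilbert space $B$ (of finite or infinite dimension). Let $p_X,p_Y$ be (discrete) probability distributions on $\mathcal X$ and $\mathcal Y$. Write $\phi_{x,y}=|\phi_{x,y}\rangle\langle\phi_{x,y}|$, $\rho_x=\sum_y p_Y(y)\phi_{x,y}$, $\rho_y=\sum_x p_X(x)\phi_{x,y}$, $\rho=\sum_{x,y}p_X(x)p_Y(y)\phi_{x,y}$, and $$H(B)=H(\rho),\quad H(B|X)=\sum_x p_X(x)H(\rho_x),\quad H(B|Y)=\sum_y p_Y(y)H(\rho_y),$$ $$H_{\min}(B|X)=\inf_{x\in\mathcal X}H_{\min}(\rho_x),\qquad H_{\min}(B|Y)=\inf_{y\in\mathcal Y}H_{\min}(\rho_y),$$ where $H(\sigma)=-\mathrm{Tr}\{\sigma\log_2\sigma\}\in[0,\infty]$ and $H_{\min}(\sigma)=-\log_2\inf\{\lambda\in\mathbb R:\sigma\le\lambda I\}$; if $H(B)<\infty$, put $I(X;B)=H(B)-H(B|X)$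 and $I(Y;B)=H(B)-H(B|Y)$. A code for $n$ channel uses consists of codewords $x^n(l)\in\mathcal X^n$ ($1\le l\le L$) and $y^n(m)\in\mathcal Y^n$ ($1\le m\le M$). The receiver is a sequential decoder: with $|\phi_{l,m}\rangle=\bigotimes_{i=1}^n|\phi_{x_i(l),y_i(m)}\rangle$, it performs the tests $\{|\phi_{l,m}\rangle\langle\phi_{l,m}|,\ I-|\phi_{l,m}\rangle\langle\phi_{l,m}|\}$ in the order $(1,1),\dots,(L,1),(1,2),\dots,(L,2),\dots,(1,M),\dots,(L,M)$ and declares the first pair whose test gives the first outcome. A pair $(R_1,R_2)$ is called achievable if for all $\varepsilon,\delta>0$ and all sufficiently large $n$ there is a code for $n$ channel uses with $L\ge 2^{n(R_1-\delta)}$, $M\ge 2^{n(R_2-\delta)}$ whose error probability under the sequential decoder, averaged over all message pairs, is at most $\varepsilon$. Consider the following sets of rate pairs with $R_1,R_2\ge 0$: $$\mathcal R_1:\ R_1\le H_{\min}(B|Y),\ R_2\le H(B|X),\ R_1+R_2\le H(B);$$ $$\mathcal R_2:\ R_1\le H(B|Y),\ R_2\le H_{\min}(B|X),\ R_1+R_2\le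 H(B);$$ $$\mathcal R:\ R_1\le H(B|Y),\ R_2\le H(B|X),\ R_1+R_2\le H(B).$$ Then: 1. every rate pair in $\mathcal R_2$ is achievable; 2. every rate pair in the convex hull of $\mathcal R_1\cup\mathcal R_2$ is achievable; 3. if $H(B)<\infty$, if the corner point $(\min\{H_{\min}(B|Y),I(X;B)\},\,H(B|X))$ equals $(I(X;B),\,H(B|X))$, and if the corner point $(H(B|Y),\,\min\{H_{\min}(B|X),I(Y;B)\})$ equals $(H(B|Y),\,I(Y;B))$, then the convex hull of $\mathcal R_1\cup\mathcal R_2$ equals $\mathcal R$. -/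

import Mathlib

open scoped ENNReal InnerProductSpace

noncomputable section

namespace SeqMAC

/-! ## Hilbert spaces, product vectors, entropies -/

/-- The Hilbert space `ℓ²(ι)`. Up to unitary equivalence every complex Hilbert space is of this
form, with `ι` finite in the finite-dimensional case; `ι` is arbitrary here. -/
abbrev Hilb (ι : Type*) := lp (fun _ : ι => ℂ) 2

/-- Bounded operators on `ℓ²(ι)`. -/
abbrev Op (ι : Type*) := Hilb ι →L[ℂ] Hilb ι

theorem summable_prod_coords {ι : Type*} : ∀ (n : ℕ) (f : Fin n → ι → ℝ),
    (∀ i b, 0 ≤ f i b) → (∀ i, Summable (f i)) →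
    Summable (fun b : Fin n → ι => ∏ i, f i (b i)) := by
  intro n
  induction n with
  | zero => intro f _ _; exact Summable.of_finite
  | succ n ih =>
    intro f h0 hs
    have h1 := ih (fun i => f i.succ) (fun i b => h0 _ _) (fun i => hs _)
    have h2 := (hs 0).mul_of_nonneg h1 (fun b => h0 0 b)
      (fun b => Finset.prod_nonneg fun i _ => h0 _ _)
    rw [← (Fin.consEquiv (fun _ : Fin (n + 1) => ι)).summable_iff]
    refine h2.congr fun x => ?_
    simp [Fin.prod_univ_succ, Fin.consEquiv]

/-- The product vector `v₁ ⊗ ⋯ ⊗ vₙ` in the `n`-fold tensor power `ℓ²(ι)^{⊗n} = ℓ²(ιⁿ)`. -/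
def tensorVec {ι : Type*} {n : ℕ} (v : Fin n → Hilb ι) : Hilb (Fin n → ι) :=
  ⟨fun b => ∏ i, v i (b i), by
    apply memℓp_gen
    have h : ∀ i, Summable fun b => ‖v i b‖ ^ (2 : ℝ≥0∞).toReal := fun i =>
      (memℓp_gen_iff (by norm_num)).1 (lp.memℓp (v i))
    refine (summable_prod_coords n (fun i b => ‖v i b‖ ^ (2 : ℝ≥0∞).toReal)
      (fun i b => by positivity) h).congr fun b => ?_
    rw [norm_prod, Real.finsetProd_rpow _ _ (fun i _ => norm_nonneg _)]⟩

/-- The operator `|v⟩⟨v|`. -/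
def ketBra {ι : Type*} (v : Hilb ι) : Op ι := InnerProductSpace.rankOne ℂ v v

open Classical in
/-- The trace of a positive operator, computed in the standard basis, with values in `[0, ∞]`. -/
def posTrace {ι : Type*} (A : Op ι) : ℝ≥0∞ :=
  ∑' i : ι, ENNReal.ofReal
    (⟪(lp.single 2 i (1 : ℂ) : Hilb ι), A (lp.single 2 i (1 : ℂ))⟫_ℂ).re

/-- The operator `- ρ log₂ ρ` of a self-adjoint operator `ρ` on a Hilbert space, given by the
continuous functional calculus. -/
def negMulLogOp {E : Type*} [NormedAddCommGroup E] [InnerProductSpace ℂ E] [CompleteSpace E]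
    (ρ : E →L[ℂ] E) : E →L[ℂ] E :=
  cfc (fun t : ℝ => -(t * Real.logb 2 t)) ρ

/-- The von Neumann entropy `H(ρ) = - Tr {ρ log₂ ρ}` of a density operator, with values in
`[0, ∞]`. -/
def vnEntropy {ι : Type*} (ρ : Op ι) : ℝ≥0∞ := posTrace (negMulLogOp ρ)

/-- The min-entropy `H_min(ρ) = - log₂ inf {λ : ρ ≤ λ I}` (Loewner order). -/
def minEntropy {ι : Type*} (ρ : Op ι) : ℝ :=
  -Real.logb 2 (sInf {c : ℝ | ρ ≤ (c : ℂ) • (1 : Op ι)})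

/-- The average state `∑ₐ p(a) ρₐ` of an ensemble. -/
def mixture {A ι : Type*} (p : PMF A) (ρ : A → Op ι) : Op ι :=
  ∑' a, ((p a).toReal : ℂ) • ρ a

/-- The conditional entropy `H(B|A) = ∑ₐ p(a) H(ρₐ)` of the classical-quantum state
`∑ₐ p(a) |a⟩⟨a| ⊗ ρₐ`. -/
def condEntropy {A ι : Type*} (p : PMF A) (ρ : A → Op ι) : ℝ≥0∞ :=
  ∑' a, p a * vnEntropy (ρ a)

/-- The conditional min-entropy `H_min(B|A) = inf_a H_min(ρₐ)`. -/
def condMinEntropy {A ι : Type*} (ρ : A → Op ι) : ℝ := ⨅ a, minEntropy (ρ a)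

/-! ## Pure-state multiple access channels, codes and sequential decoding -/

/-- A pure-state multiple access channel `x, y ↦ |φ_{x,y}⟩`. -/
structure PureMAC (X Y ι : Type*) where
  /-- the output state vector -/
  φ : X → Y → Hilb ι
  norm_φ : ∀ x y, ‖φ x y‖ = 1

/-- Codebooks for `n` channel uses: `L` codewords for the first sender and `M` codewords for the
second sender. -/
structure Code (X Y : Type*) (n L M : ℕ) where
  /-- codewords of the first sender -/
  x : Fin L → Fin n → X
  /-- codewords of the second sender -/
  y : Fin M → Fin n → Y

/-- The order in which the sequential decoder scans the message pairs:
`(1,1), (2,1), …, (L,1), (1,2), …, (L,2), …, (1,M), …, (L,M)`. -/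
def scanOrder (L M : ℕ) : List (Fin L × Fin M) :=
  (List.finRange M).flatMap fun m => (List.finRange L).map fun l => (l, m)

/-- The unnormalized state vector after the tests `{|v⟩⟨v|, I - |v⟩⟨v|}`, for `v` running through
a list, have all been answered by "no". -/
def afterNo {κ : Type*} (vs : List (Hilb κ)) (ψ : Hilb κ) : Hilb κ :=
  vs.foldl (fun χ v => (1 - ketBra v : Op κ) χ) ψ

variable {X Y ι : Type*}

/-- The channel output `|φ_{xⁿ(l), yⁿ(m)}⟩` for the message pair `(l, m)`. -/
def outputVec (W : PureMAC X Y ι) {n L M : ℕ} (C : Code X Y n L M) (k : Fin L × Fin M) :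
    Hilb (Fin n → ι) :=
  tensorVec fun i => W.φ (C.x k.1 i) (C.y k.2 i)

/-- The probability that the sequential decoder, run on the state vector `ψ`, declares the message
pair `k`: it gets the answer "no" in the tests of all pairs that come before `k` in the scanning
order and then the answer "yes" in the test of `k`. -/
def declareProb (W : PureMAC X Y ι) {n L M : ℕ} (C : Code X Y n L M) (ψ : Hilb (Fin n → ι))
    (k : Fin L × Fin M) : ℝ :=
  ‖ketBra (outputVec W C k)
    (afterNo (((scanOrder L M).takeWhile (fun j => j ≠ k)).map (outputVec W C)) ψ)‖ ^ 2

/-- The average error probability of the sequential decoder, for uniformly distributed messages. -/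
def avgError (W : PureMAC X Y ι) {n L M : ℕ} (C : Code X Y n L M) : ℝ :=
  1 - (∑ k : Fin L × Fin M, declareProb W C (outputVec W C k) k) / ((L : ℝ) * (M : ℝ))

/-- The rate pair `r = (R₁, R₂)` is achievable with sequential decoding: for all `ε, δ > 0` and
all large `n` there is a code for `n` channel uses with at least `2^{n(R₁-δ)}` and `2^{n(R₂-δ)}`
messages and with average error probability at most `ε` under the sequential decoder. -/
def SeqAchievable (W : PureMAC X Y ι) (r : ℝ × ℝ) : Prop :=
  ∀ ε > (0 : ℝ), ∀ δ > (0 : ℝ), ∃ N : ℕ, ∀ n ≥ N, ∃ (L M : ℕ) (C : Code X Y n L M),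
    (2 : ℝ) ^ ((n : ℝ) * (r.1 - δ)) ≤ L ∧ (2 : ℝ) ^ ((n : ℝ) * (r.2 - δ)) ≤ M ∧
      avgError W C ≤ ε

/-! ## Entropic quantities and rate regions -/

/-- The state `ρ_x = ∑_y p_Y(y) φ_{x,y}`. -/
def stateGivenX (W : PureMAC X Y ι) (pY : PMF Y) (x : X) : Op ι :=
  mixture pY fun y => ketBra (W.φ x y)

/-- The state `ρ_y = ∑_x p_X(x) φ_{x,y}`. -/
def stateGivenY (W : PureMAC X Y ι) (pX : PMF X) (y : Y) : Op ι :=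
  mixture pX fun x => ketBra (W.φ x y)

/-- The average output state `ρ = ∑_{x,y} p_X(x) p_Y(y) φ_{x,y}`. -/
def stateB (W : PureMAC X Y ι) (pX : PMF X) (pY : PMF Y) : Op ι :=
  ∑' z : X × Y, (((pX z.1).toReal * (pY z.2).toReal : ℝ) : ℂ) • ketBra (W.φ z.1 z.2)

/-- `H(B)`. -/
def entB (W : PureMAC X Y ι) (pX : PMF X) (pY : PMF Y) : ℝ≥0∞ := vnEntropy (stateB W pX pY)

/-- `H(B|X)`. -/
def entBX (W : PureMAC X Y ι) (pX : PMF X) (pY : PMF Y) : ℝ≥0∞ :=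
  condEntropy pX (stateGivenX W pY)

/-- `H(B|Y)`. -/
def entBY (W : PureMAC X Y ι) (pX : PMF X) (pY : PMF Y) : ℝ≥0∞ :=
  condEntropy pY (stateGivenY W pX)

/-- `H_min(B|X)`. -/
def minEntBX (W : PureMAC X Y ι) (pY : PMF Y) : ℝ := condMinEntropy (stateGivenX W pY)

/-- `H_min(B|Y)`. -/
def minEntBY (W : PureMAC X Y ι) (pX : PMF X) : ℝ := condMinEntropy (stateGivenY W pX)

/-- `I(X;B) = H(B) - H(B|X)`, used when `H(B)` is finite. -/
def infoXB (W : PureMAC X Y ι) (pX : PMF X) (pY : PMF Y) : ℝ≥0∞ := entB W pX pY - entBX W pX pY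

/-- `I(Y;B) = H(B) - H(B|Y)`, used when `H(B)` is finite. -/
def infoYB (W : PureMAC X Y ι) (pX : PMF X) (pY : PMF Y) : ℝ≥0∞ := entB W pX pY - entBY W pX pY

/-- The rate pairs with `0 ≤ R₁ ≤ a`, `0 ≤ R₂ ≤ b`, `R₁ + R₂ ≤ c`. -/
def pentagon (a b c : ℝ≥0∞) : Set (ℝ × ℝ) :=
  {r | 0 ≤ r.1 ∧ 0 ≤ r.2 ∧ ENNReal.ofReal r.1 ≤ a ∧ ENNReal.ofReal r.2 ≤ b ∧
    ENNReal.ofReal (r.1 + r.2) ≤ c}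

/-- `R₁ ≤ H_min(B|Y)`, `R₂ ≤ H(B|X)`, `R₁ + R₂ ≤ H(B)`. -/
def region₁ (W : PureMAC X Y ι) (pX : PMF X) (pY : PMF Y) : Set (ℝ × ℝ) :=
  pentagon (ENNReal.ofReal (minEntBY W pX)) (entBX W pX pY) (entB W pX pY)

/-- `R₁ ≤ H(B|Y)`, `R₂ ≤ H_min(B|X)`, `R₁ + R₂ ≤ H(B)`. -/
def region₂ (W : PureMAC X Y ι) (pX : PMF X) (pY : PMF Y) : Set (ℝ × ℝ) :=
  pentagon (entBY W pX pY) (ENNReal.ofReal (minEntBX W pY)) (entB W pX pY)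

/-- `R₁ ≤ H(B|Y)`, `R₂ ≤ H(B|X)`, `R₁ + R₂ ≤ H(B)`. -/
def fullRegion (W : PureMAC X Y ι) (pX : PMF X) (pY : PMF Y) : Set (ℝ × ℝ) :=
  pentagon (entBY W pX pY) (entBX W pX pY) (entB W pX pY)

end SeqMAC

end

/-!
# Achievable rates of a pure-state multiple access channel under sequential decoding

**Sequential decoding.** Let `φ k` be the output for the message pair `k`. If some vector `ψ k` is
close to `φ k` and nearly orthogonal to the other outputs `φ j`, then the sequential decoder errs
on `k` with small probability: the tests answered "no" before the test of `k` change the overlap of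
the state with `ψ k` by at most `(∑ⱼ |⟨φ j, ψ k⟩|²)^{1/2}`, since the probabilities of the answers
"yes" telescope and the Cauchy–Schwarz inequality applies (`norm_inner_sub_inner_afterNo_le`,
`one_sub_le_of_afterNo`). The scanning order plays no role. A code with such vectors `ψ` is a
`GoodCode`. This notion, unlike the error of a particular decoder, is visibly preserved by
exchanging the senders (`GoodAchievable.of_swap`) and by concatenating codes (`GoodCode.append`).

**Random coding.** For the rates `R₁ ≤ H(B|Y)`, `R₂ ≤ H_min(B|X)`, `R₁ + R₂ ≤ H(B)`, the codewords
are drawn independently and `ψ = P₀ P₁ φ` (`exists_goodCode`), where `P₁`, which depends on the word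
of the second sender, and `P₀` play the roles of the conditionally typical and the typical
projection. They are functions `h(∑ᵢ Gᵢ)` of sums of the one-site observables `G = min (-log₂ ρ) T`.
The truncation keeps `G` bounded when `ρ` is not invertible, and costs little entropy for large `T`
(`exists_lt_truncEntropy`). As `2^G ρ ≤ 1`, and `h` vanishes below `n K`, the operator
`h(∑ᵢ Gᵢ)` cuts the spectrum of the average state at `2^{-nK}` (`expect_inner_smoothing_le`). By
Chebyshev's inequality it hardly disturbs the average product output, provided that `K` is less than
the mean of `G` (`expect_sub_smoothing_le`). An output that shares only the first sender's word with
`k` needs no smoothing, as every `ρ_x` has spectrum below `2^{-H_min(B|X)}`; this is what the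
min-entropy buys. Exchanging the senders gives the other pentagon.

**Convex hull.** Concatenation of good codes is time sharing, so the achieved rate pairs form a
convex set (`convex_goodAchievable`). If the two pentagons reach the corners `(I(X;B), H(B|X))` and
`(H(B|Y), I(Y;B))` of the large one, each point of the large pentagon outside of both lies on a
segment of slope `-1` between them (`convexHull_pentagon_union`). The inclusion of the small
pentagons in the large one is the inequality `H_min ≤ H` (`ofReal_condMinEntropy_le`).

Expectations over codebooks take values in `[0, ∞]`, so that sums over infinite alphabets need no
summability side conditions.
-/

noncomputable section

namespace SeqMAC

/-! ### Expectations over discrete distributions -/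

/-- The expectation of a `[0, ∞]`-valued function under a discrete distribution. Values in
`[0, ∞]` make every sum meaningful and every interchange of sums legitimate. -/
def expect {A : Type*} (p : PMF A) (f : A → ℝ≥0∞) : ℝ≥0∞ := ∑' a, p a * f a

section Expect

variable {A B : Type*}

theorem expect_mono (p : PMF A) {f g : A → ℝ≥0∞} (h : ∀ a, f a ≤ g a) :
    expect p f ≤ expect p g :=
  ENNReal.tsum_le_tsum fun a => mul_le_mul_right (h a) _

theorem expect_const (p : PMF A) (c : ℝ≥0∞) : expect p (fun _ => c) = c := by
  simp [expect, ENNReal.tsum_mul_right, p.tsum_coe]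

theorem expect_le_const (p : PMF A) {f : A → ℝ≥0∞} {c : ℝ≥0∞} (h : ∀ a, f a ≤ c) :
    expect p f ≤ c :=
  (expect_mono p h).trans_eq (expect_const p c)

theorem expect_add (p : PMF A) (f g : A → ℝ≥0∞) :
    expect p (fun a => f a + g a) = expect p f + expect p g := by
  simp [expect, mul_add, ENNReal.tsum_add]

theorem expect_const_mul (p : PMF A) (c : ℝ≥0∞) (f : A → ℝ≥0∞) :
    expect p (fun a => c * f a) = c * expect p f := by
  simp [expect, ← ENNReal.tsum_mul_left, mul_left_comm]

theorem expect_finset_sum (p : PMF A) {κ : Type*} (s : Finset κ) (f : κ → A → ℝ≥0∞) :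
    expect p (fun a => ∑ k ∈ s, f k a) = ∑ k ∈ s, expect p (f k) := by
  simp only [expect, Finset.mul_sum]
  exact Summable.tsum_finsetSum fun _ _ => ENNReal.summable

theorem expect_tsum (p : PMF A) {κ : Type*} (f : κ → A → ℝ≥0∞) :
    expect p (fun a => ∑' k, f k a) = ∑' k, expect p (f k) := by
  simp only [expect, ← ENNReal.tsum_mul_left]
  exact ENNReal.tsum_comm

theorem expect_comm (p : PMF A) (q : PMF B) (f : A → B → ℝ≥0∞) :
    expect p (fun a => expect q (f a)) = expect q fun b => expect p fun a => f a b := by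
  simp only [expect, ← ENNReal.tsum_mul_left]
  rw [ENNReal.tsum_comm]
  simp only [mul_left_comm]

theorem exists_le_of_expect_le (p : PMF A) {f : A → ℝ≥0∞} {c : ℝ≥0∞} (hc : c ≠ ∞)
    (h : expect p f ≤ c) : ∃ a, f a ≤ c := by
  by_contra! hlt
  obtain ⟨a, ha⟩ := p.support_nonempty
  have h1 : expect p (fun _ => c) < expect p f := by
    refine ENNReal.tsum_lt_tsum (i := a) ?_ (fun a => mul_le_mul_right (hlt a).le _) ?_
    · change expect p (fun _ => c) ≠ ∞
      rwa [expect_const]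
    · exact (ENNReal.mul_lt_mul_iff_right ((p.mem_support_iff a).1 ha) (p.apply_ne_top a)).2 (hlt a)
  rw [expect_const] at h1
  exact absurd h (not_le.2 h1)

theorem expect_bind (p : PMF A) (q : A → PMF B) (f : B → ℝ≥0∞) :
    expect (p.bind q) f = expect p fun a => expect (q a) f := by
  simp only [expect, PMF.bind_apply, ← ENNReal.tsum_mul_left, ← ENNReal.tsum_mul_right]
  rw [ENNReal.tsum_comm]
  simp only [mul_assoc]

theorem expect_pure (a : A) (f : A → ℝ≥0∞) : expect (PMF.pure a) f = f a := by
  rw [expect, tsum_eq_single a]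
  · simp
  · intro b hb
    simp [PMF.pure_apply_of_ne _ _ hb]

theorem expect_map (p : PMF A) (g : A → B) (f : B → ℝ≥0∞) :
    expect (p.map g) f = expect p fun a => f (g a) := by
  rw [← PMF.bind_pure_comp, expect_bind]
  simp [expect_pure]

/-- The joint distribution of two independent letters. -/
def prodPMF (p : PMF A) (q : PMF B) : PMF (A × B) := p.bind fun a => q.map (Prod.mk a)

theorem expect_prodPMF (p : PMF A) (q : PMF B) (f : A × B → ℝ≥0∞) :
    expect (prodPMF p q) f = expect p fun a => expect q fun b => f (a, b) := by
  simp [prodPMF, expect_bind, expect_map]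

theorem prodPMF_apply (p : PMF A) (q : PMF B) (z : A × B) : prodPMF p q z = p z.1 * q z.2 := by
  classical
  have h : ∀ r : PMF (A × B), expect r (fun w => if w = z then 1 else 0) = r z := fun r => by
    simp [expect]
  have h' : ∀ a, expect q (fun b => if (a, b) = z then 1 else 0) =
      if a = z.1 then q z.2 else 0 := by
    intro a
    by_cases ha : a = z.1
    · subst ha
      simp [expect, Prod.ext_iff]
    · simp [expect, Prod.ext_iff, ha]
  rw [← h, expect_prodPMF]
  simp only [h']
  simp [expect]

/-- The distribution of a word of `n` independent letters. -/
def iid (p : PMF A) : (n : ℕ) → PMF (Fin n → A)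
  | 0 => PMF.pure Fin.elim0
  | n + 1 => p.bind fun a => (iid p n).map (Fin.cons a)

theorem expect_iid_zero (p : PMF A) (f : (Fin 0 → A) → ℝ≥0∞) :
    expect (iid p 0) f = f Fin.elim0 :=
  expect_pure _ _

theorem expect_iid_succ (p : PMF A) (n : ℕ) (f : (Fin (n + 1) → A) → ℝ≥0∞) :
    expect (iid p (n + 1)) f = expect p fun a => expect (iid p n) fun z => f (Fin.cons a z) := by
  simp [iid, expect_bind, expect_map]

/-- Redrawing one letter of an i.i.d. word does not change expectations. -/
theorem expect_iid_resample (p : PMF A) : ∀ (n : ℕ) (i : Fin n) (f : (Fin n → A) → ℝ≥0∞),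
    expect (iid p n) f =
      expect (iid p n) fun z => expect p fun a => f (Function.update z i a)
  | 0, i, _ => i.elim0
  | n + 1, i, f => by
    simp only [expect_iid_succ]
    induction i using Fin.cases with
    | zero => simp [Fin.update_cons_zero, expect_const, expect_comm (iid p n) p]
    | succ i =>
      congr 1
      ext a
      rw [expect_iid_resample p n i]
      simp [Fin.cons_update]

theorem expect_iid_le_of_resample (p : PMF A) {n : ℕ} (i : Fin n) {f : (Fin n → A) → ℝ≥0∞}
    {c : ℝ≥0∞} (h : ∀ z, expect p (fun a => f (Function.update z i a)) ≤ c) :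
    expect (iid p n) f ≤ c := by
  rw [expect_iid_resample p n i]
  exact expect_le_const _ h

theorem expect_iid_prodPMF (p : PMF A) (q : PMF B) : ∀ (n : ℕ) (f : (Fin n → A × B) → ℝ≥0∞),
    expect (iid (prodPMF p q) n) f =
      expect (iid p n) fun x => expect (iid q n) fun y => f fun i => (x i, y i)
  | 0, f => by
    simp only [expect_iid_zero]
    congr 1
    exact Subsingleton.elim _ _
  | n + 1, f => by
    simp only [expect_iid_succ, expect_prodPMF, expect_iid_prodPMF p q n]
    congr 1
    ext a
    rw [expect_comm (iid p n) q]
    congr 1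
    ext b
    congr 1
    ext x
    congr 1
    ext y
    congr 1
    ext i : 1
    induction i using Fin.cases <;> simp

/-- The second moment of a sum of `n` centered independent variables of second moment at most
`V` is at most `n V`; the shift `s` makes the statement inductive. -/
theorem expect_iid_sq_sum_le (p : PMF A) (g : A → ℝ) (V : ℝ≥0∞)
    (h : ∀ s : ℝ, expect p (fun a => ENNReal.ofReal ((s + g a) ^ 2)) ≤ ENNReal.ofReal (s ^ 2) + V) :
    ∀ (n : ℕ) (s : ℝ), expect (iid p n) (fun z => ENNReal.ofReal ((s + ∑ i, g (z i)) ^ 2)) ≤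
      ENNReal.ofReal (s ^ 2) + n * V
  | 0, s => by simp [expect_iid_zero]
  | n + 1, s => by
    rw [expect_iid_succ]
    calc _ ≤ expect p (fun a => ENNReal.ofReal ((s + g a) ^ 2) + n * V) := by
          refine expect_mono _ fun a => ?_
          refine le_of_eq_of_le ?_ (expect_iid_sq_sum_le p g V h n (s + g a))
          simp [Fin.sum_univ_succ, add_assoc]
      _ ≤ _ := by
          rw [expect_add, expect_const]
          refine (add_le_add_left (h s) _).trans_eq ?_
          push_cast
          ring

end Expect

/-! ### Tensor factors of `ℓ²` -/

section Slices

variable {α τ κ : Type*}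

theorem enorm_sq_eq_tsum (v : Hilb κ) : ‖v‖ₑ ^ 2 = ∑' b, ‖v b‖ₑ ^ 2 := by
  have h := lp.hasSum_norm (p := 2) (by norm_num) v
  simp only [ENNReal.toReal_ofNat, Real.rpow_ofNat] at h
  have h2 := ENNReal.ofReal_tsum_of_nonneg (fun b => sq_nonneg ‖v b‖) h.summable
  rw [h.tsum_eq] at h2
  simpa [ENNReal.ofReal_pow] using h2

theorem memℓp_of_tsum_enorm_sq_ne_top {f : κ → ℂ} (h : ∑' b, ‖f b‖ₑ ^ 2 ≠ ∞) : Memℓp f 2 := by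
  refine memℓp_gen ?_
  refine (ENNReal.summable_toReal h).congr fun b => ?_
  simp

theorem inner_eq_tsum_of_equiv (e : α × τ ≃ κ) (χ ξ : Hilb κ) :
    ⟪χ, ξ⟫_ℂ = ∑' t, ∑' a, ⟪χ (e (a, t)), ξ (e (a, t))⟫_ℂ := by
  have h := lp.summable_inner (𝕜 := ℂ) χ ξ
  rw [lp.inner_eq_tsum, ← ((Equiv.prodComm τ α).trans e).tsum_eq]
  exact (((Equiv.prodComm τ α).trans e).summable_iff.2 h).tsum_prod

/-- The `α`-component of `χ ∈ ℓ²(κ) = ℓ²(α) ⊗ ℓ²(τ)` at the basis vector `t` of `ℓ²(τ)`. The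
factorization of the index set is the equivalence `e`. -/
def slice (e : α × τ ≃ κ) (χ : Hilb κ) (t : τ) : Hilb α :=
  ⟨fun a => χ (e (a, t)), memℓp_of_tsum_enorm_sq_ne_top <| by
    have h : ∑' k, ‖χ k‖ₑ ^ 2 ≠ ∞ := by
      rw [← enorm_sq_eq_tsum]; finiteness
    exact ne_top_of_le_ne_top h (ENNReal.tsum_comp_le_tsum_of_injective
      (f := fun a => e (a, t)) (fun a b hab => by simpa using hab) _)⟩

theorem slice_apply (e : α × τ ≃ κ) (χ : Hilb κ) (t : τ) (a : α) :
    slice e χ t a = χ (e (a, t)) := rfl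

theorem slice_ext (e : α × τ ≃ κ) {χ ξ : Hilb κ} (h : ∀ t, slice e χ t = slice e ξ t) :
    χ = ξ := by
  refine lp.ext (funext fun k => ?_)
  obtain ⟨⟨a, t⟩, rfl⟩ := e.surjective k
  rw [← slice_apply, h, slice_apply]

theorem slice_add (e : α × τ ≃ κ) (χ ξ : Hilb κ) (t : τ) :
    slice e (χ + ξ) t = slice e χ t + slice e ξ t := rfl

theorem slice_smul (e : α × τ ≃ κ) (c : ℂ) (χ : Hilb κ) (t : τ) :
    slice e (c • χ) t = c • slice e χ t := rfl

theorem tsum_enorm_sq_slice (e : α × τ ≃ κ) (χ : Hilb κ) :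
    ∑' t, ‖slice e χ t‖ₑ ^ 2 = ‖χ‖ₑ ^ 2 := by
  simp only [enorm_sq_eq_tsum, slice_apply]
  rw [← e.tsum_eq, ENNReal.tsum_comm,
    ← ENNReal.tsum_prod (f := fun a t => ‖χ (e (a, t))‖ₑ ^ 2)]

theorem inner_eq_tsum_slice (e : α × τ ≃ κ) (χ ξ : Hilb κ) :
    ⟪χ, ξ⟫_ℂ = ∑' t, ⟪slice e χ t, slice e ξ t⟫_ℂ := by
  simp only [inner_eq_tsum_of_equiv e, lp.inner_eq_tsum, slice_apply]

/-- The vector of `ℓ²(α) ⊗ ℓ²(τ)` with prescribed slices. -/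
def ofSlices (e : α × τ ≃ κ) (f : τ → Hilb α) (h : ∑' t, ‖f t‖ₑ ^ 2 ≠ ∞) : Hilb κ :=
  ⟨fun k => f (e.symm k).2 (e.symm k).1, memℓp_of_tsum_enorm_sq_ne_top <| by
    rw [← e.tsum_eq]
    simp only [Equiv.symm_apply_apply]
    rw [ENNReal.tsum_prod (f := fun a t => ‖f t a‖ₑ ^ 2), ENNReal.tsum_comm]
    simpa only [← enorm_sq_eq_tsum] using h⟩

theorem slice_ofSlices (e : α × τ ≃ κ) (f : τ → Hilb α) (h : ∑' t, ‖f t‖ₑ ^ 2 ≠ ∞) (t : τ) :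
    slice e (ofSlices e f h) t = f t := by
  refine lp.ext (funext fun a => ?_)
  simp [slice_apply, ofSlices]

/-- The product vector `v ⊗ w`. -/
def tens (e : α × τ ≃ κ) (v : Hilb α) (w : Hilb τ) : Hilb κ :=
  ofSlices e (fun t => w t • v) <| by
    simp only [enorm_smul, mul_pow]
    rw [ENNReal.tsum_mul_right, ← enorm_sq_eq_tsum]
    finiteness

theorem slice_tens (e : α × τ ≃ κ) (v : Hilb α) (w : Hilb τ) (t : τ) :
    slice e (tens e v w) t = w t • v := slice_ofSlices _ _ _ _

theorem tens_sub_left (e : α × τ ≃ κ) (v v' : Hilb α) (w : Hilb τ) :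
    tens e (v - v') w = tens e v w - tens e v' w := by
  refine slice_ext e fun t => ?_
  rw [slice_tens, smul_sub, ← slice_tens e, ← slice_tens e]
  rfl

theorem tens_sub_right (e : α × τ ≃ κ) (v : Hilb α) (w w' : Hilb τ) :
    tens e v (w - w') = tens e v w - tens e v w' := by
  refine slice_ext e fun t => ?_
  rw [slice_tens, lp.coeFn_sub, Pi.sub_apply, sub_smul, ← slice_tens e, ← slice_tens e]
  rfl

theorem inner_tens_tens (e : α × τ ≃ κ) (v v' : Hilb α) (w w' : Hilb τ) :
    ⟪tens e v w, tens e v' w'⟫_ℂ = ⟪v, v'⟫_ℂ * ⟪w, w'⟫_ℂ := by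
  rw [inner_eq_tsum_slice e, lp.inner_eq_tsum w, ← tsum_mul_left]
  refine tsum_congr fun t => ?_
  simp only [slice_tens, inner_smul_left, inner_smul_right]
  simp only [RCLike.inner_apply]
  ring

theorem enorm_tens (e : α × τ ≃ κ) (v : Hilb α) (w : Hilb τ) :
    ‖tens e v w‖ₑ = ‖v‖ₑ * ‖w‖ₑ := by
  refine (ENNReal.pow_right_strictMono two_ne_zero).injective ?_
  rw [← tsum_enorm_sq_slice e, mul_pow, enorm_sq_eq_tsum w, mul_comm, ← ENNReal.tsum_mul_right]
  simp [slice_tens, enorm_smul, mul_pow]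

theorem norm_tens (e : α × τ ≃ κ) (v : Hilb α) (w : Hilb τ) :
    ‖tens e v w‖ = ‖v‖ * ‖w‖ := by
  simpa using congrArg ENNReal.toReal (enorm_tens e v w)

theorem enorm_inner_le (v w : Hilb α) : ‖⟪v, w⟫_ℂ‖ₑ ≤ ‖v‖ₑ * ‖w‖ₑ := by
  rw [← ofReal_norm, ← ofReal_norm, ← ofReal_norm, ← ENNReal.ofReal_mul (norm_nonneg _)]
  exact ENNReal.ofReal_le_ofReal (norm_inner_le_norm _ _)

/-- The partial inner product `(⟨v| ⊗ 1) χ`. -/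
def contract (e : α × τ ≃ κ) (v : Hilb α) (χ : Hilb κ) : Hilb τ :=
  ⟨fun t => ⟪v, slice e χ t⟫_ℂ, memℓp_of_tsum_enorm_sq_ne_top <| by
    refine ne_top_of_le_ne_top (b := ‖v‖ₑ ^ 2 * ‖χ‖ₑ ^ 2) (by finiteness) ?_
    rw [← tsum_enorm_sq_slice e, ← ENNReal.tsum_mul_left]
    refine ENNReal.tsum_le_tsum fun t => ?_
    rw [← mul_pow]
    gcongr
    exact enorm_inner_le _ _⟩

theorem inner_tens_left (e : α × τ ≃ κ) (v : Hilb α) (w : Hilb τ) (χ : Hilb κ) :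
    ⟪tens e v w, χ⟫_ℂ = ⟪w, contract e v χ⟫_ℂ := by
  rw [inner_eq_tsum_slice e, lp.inner_eq_tsum]
  refine tsum_congr fun t => ?_
  simp only [slice_tens, inner_smul_left]
  simp only [RCLike.inner_apply, contract]
  ring

/-- Bessel-type inequalities tensorize. -/
theorem expect_inner_tens_le {A B : Type*} (e : α × τ ≃ κ) (p : PMF A) (q : PMF B)
    (v : A → Hilb α) (w : B → Hilb τ) (c d : ℝ≥0∞)
    (hv : ∀ χ, expect p (fun a => ‖⟪v a, χ⟫_ℂ‖ₑ ^ 2) ≤ c * ‖χ‖ₑ ^ 2)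
    (hw : ∀ χ, expect q (fun b => ‖⟪w b, χ⟫_ℂ‖ₑ ^ 2) ≤ d * ‖χ‖ₑ ^ 2) (χ : Hilb κ) :
    expect p (fun a => expect q fun b => ‖⟪tens e (v a) (w b), χ⟫_ℂ‖ₑ ^ 2) ≤
      c * d * ‖χ‖ₑ ^ 2 := by
  calc _ ≤ expect p (fun a => d * ∑' t, ‖⟪v a, slice e χ t⟫_ℂ‖ₑ ^ 2) := by
        refine expect_mono _ fun a => ?_
        simp only [inner_tens_left]
        refine (hw _).trans_eq ?_
        rw [enorm_sq_eq_tsum]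
        rfl
    _ ≤ d * ∑' t, c * ‖slice e χ t‖ₑ ^ 2 := by
        rw [expect_const_mul, expect_tsum]
        gcongr
        exact hv _
    _ = _ := by
        rw [ENNReal.tsum_mul_left, tsum_enorm_sq_slice]
        ring

theorem tsum_enorm_sq_map_slice_le (e : α × τ ≃ κ) (A : Op α) (χ : Hilb κ) :
    ∑' t, ‖A (slice e χ t)‖ₑ ^ 2 ≤ (‖A‖ₑ * ‖χ‖ₑ) ^ 2 := by
  rw [mul_pow, ← tsum_enorm_sq_slice e, ← ENNReal.tsum_mul_left]
  refine ENNReal.tsum_le_tsum fun t => ?_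
  rw [← mul_pow]
  gcongr
  exact A.le_opENorm _

theorem tsum_enorm_sq_map_slice_ne_top (e : α × τ ≃ κ) (A : Op α) (χ : Hilb κ) :
    ∑' t, ‖A (slice e χ t)‖ₑ ^ 2 ≠ ∞ :=
  ne_top_of_le_ne_top (by finiteness) (tsum_enorm_sq_map_slice_le e A χ)

/-- The operator `A ⊗ 1`. -/
def amp (e : α × τ ≃ κ) (A : Op α) : Op κ :=
  LinearMap.mkContinuous
    { toFun := fun χ => ofSlices e (fun t => A (slice e χ t))
        (tsum_enorm_sq_map_slice_ne_top e A χ)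
      map_add' := fun χ ξ => slice_ext e fun t => by
        simp [slice_add, slice_ofSlices]
      map_smul' := fun c χ => slice_ext e fun t => by
        simp [slice_smul, slice_ofSlices] }
    ‖A‖ fun χ => by
      have h : ‖ofSlices e (fun t => A (slice e χ t)) (tsum_enorm_sq_map_slice_ne_top e A χ)‖ₑ ≤
          ‖A‖ₑ * ‖χ‖ₑ := by
        rw [← ENNReal.pow_le_pow_left_iff two_ne_zero, ← tsum_enorm_sq_slice e]
        simpa only [slice_ofSlices] using tsum_enorm_sq_map_slice_le e A χ
      have := ENNReal.toReal_mono (by finiteness) h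
      simpa using this

theorem slice_amp (e : α × τ ≃ κ) (A : Op α) (χ : Hilb κ) (t : τ) :
    slice e (amp e A χ) t = A (slice e χ t) :=
  slice_ofSlices e _ (tsum_enorm_sq_map_slice_ne_top e A χ) t

/-- `A ↦ A ⊗ 1` as a homomorphism of `*`-algebras. -/
def ampHom (e : α × τ ≃ κ) : Op α →⋆ₐ[ℂ] Op κ where
  toFun := amp e
  map_one' := by
    ext1 χ
    exact slice_ext e fun t => by simp [slice_amp]
  map_mul' A B := by
    ext1 χ
    exact slice_ext e fun t => by simp [slice_amp]
  map_zero' := by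
    ext1 χ
    exact slice_ext e fun t => by rw [slice_amp]; rfl
  map_add' A B := by
    ext1 χ
    exact slice_ext e fun t => by simp [slice_amp, slice_add]
  commutes' c := by
    ext1 χ
    exact slice_ext e fun t => by
      simp [slice_amp, Algebra.algebraMap_eq_smul_one, slice_smul]
  map_star' A := by
    rw [ContinuousLinearMap.star_eq_adjoint, ContinuousLinearMap.star_eq_adjoint,
      ContinuousLinearMap.eq_adjoint_iff]
    intro χ ξ
    simp only [inner_eq_tsum_slice e, slice_amp, ContinuousLinearMap.adjoint_inner_left]

end Slices

/-! ### Product vectors and one-site operators -/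

section Sites

variable {ι : Type*} {n : ℕ}

theorem tensorVec_apply (v : Fin n → Hilb ι) (b : Fin n → ι) :
    tensorVec v b = ∏ i, v i (b i) := rfl

/-- The splitting of a word into its first letter and the rest. -/
abbrev headEquiv (ι : Type*) (n : ℕ) : ι × (Fin n → ι) ≃ (Fin (n + 1) → ι) :=
  Fin.consEquiv fun _ => ι

theorem tensorVec_succ (v : Fin (n + 1) → Hilb ι) :
    tensorVec v = tens (headEquiv ι n) (v 0) (tensorVec fun i => v i.succ) := by
  refine slice_ext (headEquiv ι n) fun t => lp.ext (funext fun a => ?_)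
  rw [slice_tens, slice_apply]
  simp [tensorVec_apply, Fin.prod_univ_succ, Fin.consEquiv, mul_comm]

theorem inner_tensorVec : ∀ {n : ℕ} (v w : Fin n → Hilb ι),
    ⟪tensorVec v, tensorVec w⟫_ℂ = ∏ i, ⟪v i, w i⟫_ℂ
  | 0, v, w => by
    rw [lp.inner_eq_tsum]
    simp [tensorVec_apply]
  | n + 1, v, w => by
    rw [tensorVec_succ, tensorVec_succ, inner_tens_tens, inner_tensorVec, Fin.prod_univ_succ]

theorem norm_tensorVec (v : Fin n → Hilb ι) (hv : ∀ i, ‖v i‖ = 1) : ‖tensorVec v‖ = 1 := by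
  have h1 : ∀ i, ⟪v i, v i⟫_ℂ = 1 := fun i => by simp [inner_self_eq_norm_sq_to_K, hv]
  have h : ‖tensorVec v‖ ^ 2 = 1 := by
    rw [← inner_self_eq_norm_sq (𝕜 := ℂ), inner_tensorVec]
    simp only [h1, Finset.prod_const_one, RCLike.one_re]
  exact (pow_eq_one_iff_of_nonneg (norm_nonneg _) two_ne_zero).1 h

/-- The Bessel-type inequality for words of independent letters. -/
theorem expect_inner_tensorVec_le {A B : Type*} (p : PMF B) (v : A → B → Hilb ι) (c : ℝ≥0∞)
    (h : ∀ a χ, expect p (fun b => ‖⟪v a b, χ⟫_ℂ‖ₑ ^ 2) ≤ c * ‖χ‖ₑ ^ 2) :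
    ∀ {n : ℕ} (a : Fin n → A) (χ : Hilb (Fin n → ι)),
      expect (iid p n) (fun b => ‖⟪tensorVec fun i => v (a i) (b i), χ⟫_ℂ‖ₑ ^ 2) ≤
        c ^ n * ‖χ‖ₑ ^ 2
  | 0, a, χ => by
    rw [expect_iid_zero, pow_zero, one_mul]
    refine (pow_le_pow_left' (enorm_inner_le _ _) 2).trans_eq ?_
    rw [← ofReal_norm, norm_tensorVec _ fun i => i.elim0]
    simp
  | n + 1, a, χ => by
    rw [expect_iid_succ]
    simp only [tensorVec_succ, Fin.cons_zero, Fin.cons_succ]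
    rw [pow_succ']
    exact expect_inner_tens_le (headEquiv ι n) p (iid p n) (v (a 0)) _ c (c ^ n) (h _)
      (expect_inner_tensorVec_le p v c h fun i => a i.succ) χ

/-- The splitting of a word into its `i`-th letter and the rest. -/
abbrev siteEquiv (ι : Type*) (i : Fin n) : ι × ({j // j ≠ i} → ι) ≃ (Fin n → ι) :=
  (Equiv.funSplitAt i ι).symm

theorem slice_tensorVec (v : Fin n → Hilb ι) (i : Fin n) (t : {j // j ≠ i} → ι) :
    slice (siteEquiv ι i) (tensorVec v) t = (∏ j : {j // j ≠ i}, v j (t j)) • v i := by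
  refine lp.ext (funext fun a => ?_)
  rw [slice_apply, tensorVec_apply, Fintype.prod_eq_mul_prod_subtype_ne _ i]
  simp only [Equiv.funSplitAt_symm_apply, dite_true, lp.coeFn_smul, Pi.smul_apply, smul_eq_mul]
  rw [mul_comm]
  congr 1
  refine Finset.prod_congr rfl fun j _ => ?_
  simp [j.2]

/-- The operator acting as `A` on the `i`-th tensor factor. -/
abbrev siteHom (ι : Type*) (i : Fin n) : Op ι →⋆ₐ[ℂ] Op (Fin n → ι) := ampHom (siteEquiv ι i)

theorem siteHom_tensorVec (i : Fin n) (A : Op ι) (v : Fin n → Hilb ι) :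
    siteHom ι i A (tensorVec v) = tensorVec (Function.update v i (A (v i))) := by
  refine slice_ext (siteEquiv ι i) fun t => ?_
  rw [slice_tensorVec]
  refine (slice_amp _ _ _ _).trans ?_
  rw [slice_tensorVec]
  simp only [map_smul, Function.update_self]
  congr 1
  refine Finset.prod_congr rfl fun j _ => ?_
  rw [Function.update_of_ne j.2]

open Classical in
/-- Bounded operators are determined by their values on product vectors, as the standard basis
consists of product vectors. -/
theorem op_ext_tensorVec {S T : Op (Fin n → ι)}
    (h : ∀ v : Fin n → Hilb ι, S (tensorVec v) = T (tensorVec v)) : S = T := by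
  refine lp.ext_continuousLinearMap (by norm_num) fun b => ?_
  ext1
  have hb : (lp.single 2 b (1 : ℂ) : Hilb (Fin n → ι)) =
      tensorVec fun i => lp.single 2 (b i) 1 := by
    refine lp.ext (funext fun c => ?_)
    rw [tensorVec_apply]
    simp only [lp.single_apply, Pi.single_apply, Finset.prod_ite_zero, funext_iff]
    simp
  simp [hb, h]

theorem commute_siteHom {i j : Fin n} (hij : i ≠ j) (A B : Op ι) :
    Commute (siteHom ι i A) (siteHom ι j B) := by
  refine op_ext_tensorVec fun v => ?_
  simp only [mul_apply_eq_comp, siteHom_tensorVec]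
  rw [Function.update_of_ne hij, Function.update_of_ne hij.symm, Function.update_comm hij]

theorem continuous_siteHom (i : Fin n) : Continuous (siteHom ι i) := by
  fun_prop

/-- The exponential of a sum of commuting one-site operators acts factorwise. -/
theorem exp_sum_siteHom (A : Fin n → Op ι) (s : Finset (Fin n)) (v : Fin n → Hilb ι) :
    NormedSpace.exp (∑ i ∈ s, siteHom ι i (A i)) (tensorVec v) =
      tensorVec fun i => if i ∈ s then NormedSpace.exp (A i) (v i) else v i := by
  let : NormedAlgebra ℚ (Op ι) := NormedAlgebra.restrictScalars ℚ ℂ _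
  let : NormedAlgebra ℚ (Op (Fin n → ι)) := NormedAlgebra.restrictScalars ℚ ℂ _
  classical
  induction s using Finset.induction_on with
  | empty => simp
  | insert i s hi ih =>
    rw [Finset.sum_insert hi, NormedSpace.exp_add_of_commute, mul_apply_eq_comp, ih,
      ← NormedSpace.map_exp (siteHom ι i) (continuous_siteHom i), siteHom_tensorVec]
    · congr 1
      ext1 j
      by_cases hj : j = i
      · subst hj
        simp [hi]
      · simp [hj]
    · refine Commute.sum_right _ _ _ fun j hj => commute_siteHom ?_ _ _
      rintro rfl
      exact hi hj

end Sites

/-! ### Functional calculus of self-adjoint operators -/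

section FunctionalCalculus

variable {E : Type*} [NormedAddCommGroup E] [InnerProductSpace ℂ E]

theorem re_inner_le_of_le {S T : E →L[ℂ] E} (h : S ≤ T) (v : E) :
    (⟪v, S v⟫_ℂ).re ≤ (⟪v, T v⟫_ℂ).re := by
  have h1 := ((ContinuousLinearMap.le_def _ _).1 h).re_inner_nonneg_right v
  simp only [sub_apply, inner_sub_right, map_sub] at h1
  simpa using h1

variable [CompleteSpace E]

theorem inner_selfAdjoint {S : E →L[ℂ] E} (hS : IsSelfAdjoint S) (v w : E) :
    ⟪S v, w⟫_ℂ = ⟪v, S w⟫_ℂ :=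
  ContinuousLinearMap.isSelfAdjoint_iff_isSymmetric.1 hS v w

/-- The operator `h(S)` of a self-adjoint operator `S`. It is a name for `cfc` on an abstract
Hilbert space, through which the functional calculus is applied to operators on `ℓ²(ι)`. -/
def fc (h : ℝ → ℝ) (S : E →L[ℂ] E) : E →L[ℂ] E := cfc h S

theorem isSelfAdjoint_fc (f : ℝ → ℝ) (S : E →L[ℂ] E) : IsSelfAdjoint (fc f S) :=
  cfc_predicate f S

theorem fc_mul {f g : ℝ → ℝ} (hf : Continuous f) (hg : Continuous g) (S : E →L[ℂ] E) (v : E) :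
    fc (fun t => f t * g t) S v = fc f S (fc g S v) := by
  rw [fc, cfc_mul f g S hf.continuousOn hg.continuousOn]
  rfl

theorem fc_id {S : E →L[ℂ] E} (hS : IsSelfAdjoint S) : fc (fun t => t) S = S := cfc_id' ℝ S hS

theorem fc_const {S : E →L[ℂ] E} (hS : IsSelfAdjoint S) (c : ℝ) (v : E) :
    fc (fun _ => c) S v = (c : ℂ) • v := by
  rw [fc, cfc_const c S hS]
  simp [Algebra.algebraMap_eq_smul_one]

theorem fc_sub {f g : ℝ → ℝ} (hf : Continuous f) (hg : Continuous g) (S : E →L[ℂ] E) :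
    fc (fun t => f t - g t) S = fc f S - fc g S :=
  cfc_sub f g S hf.continuousOn hg.continuousOn

theorem fc_exp {S : E →L[ℂ] E} (hS : IsSelfAdjoint S) {g : ℝ → ℝ} (hg : Continuous g) (c : ℝ) :
    NormedSpace.exp ((c : ℂ) • fc g S) = fc (fun t => Real.exp (c * g t)) S := by
  have h1 : (c : ℂ) • fc g S = cfc (fun t => c * g t) S := by
    rw [cfc_const_mul c g S hg.continuousOn]
    ext v
    simp [fc]
  rw [h1, ← CFC.real_exp_eq_normedSpace_exp (cfc_predicate _ _), fc,
    cfc_comp' Real.exp (fun t => c * g t) S (by fun_prop) (by fun_prop) hS]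

theorem norm_sq_fc_apply {f : ℝ → ℝ} (hf : Continuous f) (S : E →L[ℂ] E) (v : E) :
    ‖fc f S v‖ ^ 2 = (⟪v, fc (fun t => f t * f t) S v⟫_ℂ).re := by
  rw [fc_mul hf hf, ← inner_selfAdjoint (isSelfAdjoint_fc f S)]
  exact (inner_self_eq_norm_sq (𝕜 := ℂ) _).symm

theorem norm_fc_apply_le {f g : ℝ → ℝ} {S : E →L[ℂ] E} (hf : Continuous f)
    (hg : Continuous g) (h : ∀ t, |f t| ≤ |g t|) (v : E) : ‖fc f S v‖ ≤ ‖fc g S v‖ := by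
  refine le_of_sq_le_sq ?_ (norm_nonneg _)
  rw [norm_sq_fc_apply hf, norm_sq_fc_apply hg]
  refine re_inner_le_of_le (cfc_mono (fun t ht => ?_) (by fun_prop) (by fun_prop)) v
  have := sq_le_sq.2 (h t)
  nlinarith

/-- The form bounds `0 ≤ S ≤ c` confine the spectrum of `S`. -/
theorem spectrum_mem_Icc {S : E →L[ℂ] E} (h0 : 0 ≤ S) {c : ℝ}
    (h1 : ∀ v, (⟪v, S v⟫_ℂ).re ≤ c * ‖v‖ ^ 2) {t : ℝ} (ht : t ∈ spectrum ℝ S) :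
    t ∈ Set.Icc 0 c := by
  refine ⟨spectrum_nonneg_of_nonneg h0 ht,
    (le_algebraMap_iff_spectrum_le (.of_nonneg h0)).1 ?_ t ht⟩
  have hsa : IsSelfAdjoint (algebraMap ℝ (E →L[ℂ] E) c - S) :=
    (IsSelfAdjoint.algebraMap _ (.all c)).sub (.of_nonneg h0)
  rw [ContinuousLinearMap.le_def, ContinuousLinearMap.isPositive_def]
  refine ⟨ContinuousLinearMap.isSelfAdjoint_iff_isSymmetric.1 hsa, fun v => ?_⟩
  rw [ContinuousLinearMap.reApplyInnerSelf_apply, inner_selfAdjoint hsa, ← inner_selfAdjoint hsa]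
  have := h1 v
  have h2 : ⟪v, S v⟫_ℂ = ⟪S v, v⟫_ℂ := (inner_selfAdjoint (.of_nonneg h0) v v).symm
  rw [h2] at this
  simpa [Algebra.algebraMap_eq_smul_one, inner_sub_left, inner_smul_left, ← Complex.ofReal_pow,
    inner_self_eq_norm_sq_to_K] using this

theorem re_inner_fc_le {f g : ℝ → ℝ} (hf : Continuous f) (hg : Continuous g)
    {S : E →L[ℂ] E} (h0 : 0 ≤ S) {c : ℝ} (h1 : ∀ v, (⟪v, S v⟫_ℂ).re ≤ c * ‖v‖ ^ 2)
    (h : ∀ t ∈ Set.Icc 0 c, f t ≤ g t) (v : E) :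
    (⟪v, fc f S v⟫_ℂ).re ≤ (⟪v, fc g S v⟫_ℂ).re :=
  re_inner_le_of_le (cfc_mono (fun t ht => h t (spectrum_mem_Icc h0 h1 ht))
    hf.continuousOn hg.continuousOn) v

theorem fc_congr {f g : ℝ → ℝ} {S : E →L[ℂ] E} (h0 : 0 ≤ S) {c : ℝ}
    (h1 : ∀ v, (⟪v, S v⟫_ℂ).re ≤ c * ‖v‖ ^ 2) (h : ∀ t ∈ Set.Icc 0 c, f t = g t) :
    fc f S = fc g S :=
  cfc_congr fun t ht => h t (spectrum_mem_Icc h0 h1 ht)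

end FunctionalCalculus

/-! ### Mixtures of pure states -/

section Mixture

theorem hasSum_toReal {A : Type*} (p : PMF A) : HasSum (fun a => (p a).toReal) 1 := by
  have h := ENNReal.hasSum_toReal (f := fun a => p a) (by rw [p.tsum_coe]; simp)
  rwa [← ENNReal.tsum_toReal_eq p.apply_ne_top, p.tsum_coe, ENNReal.toReal_one] at h

variable {E : Type*} [NormedAddCommGroup E] [InnerProductSpace ℂ E]

/-- The average of the pure states `|f a⟩⟨f a|`. -/
def avgState {A : Type*} (p : PMF A) (f : A → E) : E →L[ℂ] E :=
  ∑' a, ((p a).toReal : ℂ) • InnerProductSpace.rankOne ℂ (f a) (f a)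

variable [CompleteSpace E]

variable {A : Type*} (p : PMF A) {f : A → E}

theorem summable_avgState (hf : ∀ a, ‖f a‖ = 1) :
    Summable fun a => ((p a).toReal : ℂ) • InnerProductSpace.rankOne ℂ (f a) (f a) := by
  refine Summable.of_norm ((hasSum_toReal p).summable.congr fun a => ?_)
  rw [norm_smul, InnerProductSpace.norm_rankOne, hf]
  simp

theorem hasSum_inner_avgState (hf : ∀ a, ‖f a‖ = 1) (v : E) :
    HasSum (fun a => (((p a).toReal * ‖⟪f a, v⟫_ℂ‖ ^ 2 : ℝ) : ℂ)) ⟪v, avgState p f v⟫_ℂ := by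
  have h := (summable_avgState p hf).hasSum
  have h2 := (h.mapL (ContinuousLinearMap.apply ℂ E v)).mapL (innerSL ℂ v)
  refine h2.congr_fun fun a => ?_
  simp only [ContinuousLinearMap.apply_apply, smul_apply,
    InnerProductSpace.rankOne_apply, innerSL_apply_apply, inner_smul_right]
  rw [← inner_conj_symm v (f a), Complex.mul_conj, Complex.normSq_eq_norm_sq]
  push_cast
  rfl

theorem hasSum_re_inner_avgState (hf : ∀ a, ‖f a‖ = 1) (v : E) :
    HasSum (fun a => (p a).toReal * ‖⟪f a, v⟫_ℂ‖ ^ 2) (⟪v, avgState p f v⟫_ℂ).re :=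
  Complex.hasSum_re (hasSum_inner_avgState p hf v)

theorem ofReal_inner_avgState (hf : ∀ a, ‖f a‖ = 1) (v : E) :
    ENNReal.ofReal (⟪v, avgState p f v⟫_ℂ).re = expect p fun a => ‖⟪f a, v⟫_ℂ‖ₑ ^ 2 := by
  have h := hasSum_re_inner_avgState p hf v
  rw [← h.tsum_eq, ENNReal.ofReal_tsum_of_nonneg (fun a => by positivity) h.summable]
  refine tsum_congr fun a => ?_
  rw [ENNReal.ofReal_mul ENNReal.toReal_nonneg, ENNReal.ofReal_toReal (p.apply_ne_top a),
    ENNReal.ofReal_pow (norm_nonneg _), ofReal_norm]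

theorem avgState_nonneg (hf : ∀ a, ‖f a‖ = 1) : 0 ≤ avgState p f := by
  rw [ContinuousLinearMap.nonneg_iff_isPositive, ContinuousLinearMap.isPositive_iff_complex]
  intro v
  have h := hasSum_re_inner_avgState p hf v
  have h2 := hasSum_inner_avgState p hf v
  have h3 : (((⟪v, avgState p f v⟫_ℂ).re : ℝ) : ℂ) = ⟪v, avgState p f v⟫_ℂ :=
    (Complex.hasSum_ofReal.2 h).unique h2
  have h4 : ⟪avgState p f v, v⟫_ℂ = ⟪v, avgState p f v⟫_ℂ := by
    rw [← inner_conj_symm, ← h3, Complex.conj_ofReal]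
  rw [h4]
  exact ⟨h3, h.nonneg fun a => by positivity⟩

theorem isSelfAdjoint_avgState (hf : ∀ a, ‖f a‖ = 1) : IsSelfAdjoint (avgState p f) :=
  .of_nonneg (avgState_nonneg p hf)

theorem re_inner_avgState_le (hf : ∀ a, ‖f a‖ = 1) (v : E) :
    (⟪v, avgState p f v⟫_ℂ).re ≤ 1 * ‖v‖ ^ 2 := by
  refine hasSum_le (fun a => ?_) (hasSum_re_inner_avgState p hf v)
    ((hasSum_toReal p).mul_right (‖v‖ ^ 2))
  have := norm_inner_le_norm (𝕜 := ℂ) (f a) v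
  rw [hf, one_mul] at this
  gcongr

theorem avgState_le_smul_one_iff (hf : ∀ a, ‖f a‖ = 1) (c : ℝ) :
    avgState p f ≤ (c : ℂ) • (1 : E →L[ℂ] E) ↔
      ∀ v, (⟪v, avgState p f v⟫_ℂ).re ≤ c * ‖v‖ ^ 2 := by
  constructor
  · intro h v
    have := re_inner_le_of_le h v
    simpa [inner_smul_right, inner_self_eq_norm_sq_to_K, ← Complex.ofReal_pow] using this
  · intro h
    have h0 := avgState_nonneg p hf
    have := (le_algebraMap_iff_spectrum_le (R := ℝ) (r := c) (isSelfAdjoint_avgState p hf)).2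
      fun t ht => (spectrum_mem_Icc h0 h ht).2
    refine this.trans_eq ?_
    ext v
    simp [Algebra.algebraMap_eq_smul_one]

/-- `Tr{|v⟩⟨v| h(ρ) ρ h(ρ)}` as an average over the ensemble of `ρ`. -/
theorem expect_inner_fc (hf : ∀ a, ‖f a‖ = 1) {h : ℝ → ℝ} (hh : Continuous h) (v : E) :
    expect p (fun a => ‖⟪fc h (avgState p f) (f a), v⟫_ℂ‖ₑ ^ 2) =
      ENNReal.ofReal (⟪v, fc (fun t => h t * (t * h t)) (avgState p f) v⟫_ℂ).re := by
  have hs := isSelfAdjoint_avgState p hf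
  rw [fc_mul hh (by fun_prop), fc_mul continuous_id' hh, fc_id hs,
    ← inner_selfAdjoint (isSelfAdjoint_fc h _), ofReal_inner_avgState p hf]
  simp only [inner_selfAdjoint (isSelfAdjoint_fc h _)]

end Mixture

section Trace

variable {A ι : Type*} (p : PMF A) {f : A → Hilb ι}

theorem mixture_eq (f : A → Hilb ι) : mixture p (fun a => ketBra (f a)) = avgState p f := rfl

theorem stateB_eq {X Y : Type*} (W : PureMAC X Y ι) (pX : PMF X) (pY : PMF Y) :
    stateB W pX pY = avgState (prodPMF pX pY) fun z => W.φ z.1 z.2 := by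
  rw [← mixture_eq]
  simp [stateB, mixture, prodPMF_apply]

/-- `Tr{ρ g(ρ)}` as an average over the ensemble of `ρ`. -/
theorem posTrace_fc_mul (hf : ∀ a, ‖f a‖ = 1) {g : ℝ → ℝ} (hg : Continuous g)
    (h0 : ∀ t ∈ Set.Icc (0 : ℝ) 1, 0 ≤ g t) :
    posTrace (fc (fun t => t * g t) (avgState p f)) =
      expect p fun a => ENNReal.ofReal (⟪f a, fc g (avgState p f) (f a)⟫_ℂ).re := by
  classical
  -- By cyclicity of the trace, `Tr{ρ g(ρ)}` is the trace of `√g(ρ) ρ √g(ρ)`.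
  have hc : Continuous (fun t => √(g t)) := by fun_prop
  have hcongr := fun g g' => fc_congr (f := g) (g := g') (avgState_nonneg p hf)
    (re_inner_avgState_le p hf)
  have h1 := hcongr (fun t => t * g t) (fun t => √(g t) * (t * √(g t))) fun t ht => by
      have := Real.mul_self_sqrt (h0 t ht)
      linear_combination (-t) * this
  have h2 := hcongr g (fun t => √(g t) * √(g t)) fun t ht => (Real.mul_self_sqrt (h0 t ht)).symm
  rw [h1, h2, posTrace]
  simp only [← norm_sq_fc_apply hc, ← expect_inner_fc p hf hc]
  rw [← expect_tsum]
  congr 1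
  ext a
  rw [ENNReal.ofReal_pow (norm_nonneg _), ofReal_norm, enorm_sq_eq_tsum]
  refine tsum_congr fun i => ?_
  rw [← ofReal_norm, norm_inner_symm]
  convert rfl using 3
  rw [lp.inner_single_left]
  simp

end Trace

/-! ### Truncated logarithms and the von Neumann entropy -/

section TruncLog

/-- The function `min (-log₂ t) T`, in a form that is continuous at `t = 0`. -/
def truncLog (T : ℕ) (t : ℝ) : ℝ := -Real.logb 2 (max t ((2 : ℝ) ^ T)⁻¹)

theorem continuous_truncLog (T : ℕ) : Continuous (truncLog T) := by
  have h : ∀ t : ℝ, max t ((2 : ℝ) ^ T)⁻¹ ≠ 0 := fun t =>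
    (lt_max_of_lt_right (by positivity)).ne'
  unfold truncLog Real.logb
  fun_prop (disch := assumption)

theorem truncLog_nonneg (T : ℕ) {t : ℝ} (ht : t ≤ 1) : 0 ≤ truncLog T t := by
  have h1 : max t ((2 : ℝ) ^ T)⁻¹ ≤ 1 := max_le ht (inv_le_one_of_one_le₀ (one_le_pow₀ one_le_two))
  have := Real.logb_nonpos one_lt_two (lt_max_of_lt_right (b := t) (by positivity)).le h1
  simp only [truncLog]
  linarith

theorem truncLog_le (T : ℕ) (t : ℝ) : truncLog T t ≤ T := by
  have h : Real.logb 2 ((2 : ℝ) ^ T)⁻¹ = -T := by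
    rw [Real.logb_inv, Real.logb_pow, Real.logb_self_eq_one one_lt_two, mul_one]
  have := Real.logb_le_logb_of_le one_lt_two (by positivity) (le_max_right t ((2 : ℝ) ^ T)⁻¹)
  simp only [truncLog]
  linarith

theorem exp_truncLog (T : ℕ) (t : ℝ) :
    Real.exp (Real.log 2 * truncLog T t) = (max t ((2 : ℝ) ^ T)⁻¹)⁻¹ := by
  have h0 : 0 < max t ((2 : ℝ) ^ T)⁻¹ := lt_max_of_lt_right (by positivity)
  have h : Real.log 2 * truncLog T t = -Real.log (max t ((2 : ℝ) ^ T)⁻¹) := by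
    have : Real.log 2 ≠ 0 := (Real.log_pos one_lt_two).ne'
    simp only [truncLog, Real.logb]
    field_simp
  rw [h, Real.exp_neg, Real.exp_log h0]

theorem mul_truncLog_le (T : ℕ) {t : ℝ} (ht : 0 ≤ t) :
    t * truncLog T t ≤ -(t * Real.logb 2 t) := by
  rcases ht.eq_or_lt with rfl | ht'
  · simp
  have := Real.logb_le_logb_of_le one_lt_two ht' (le_max_left t ((2 : ℝ) ^ T)⁻¹)
  simp only [truncLog]
  nlinarith

/-- Truncating the logarithm changes `-t log₂ t` by an amount that tends to `0` uniformly in `t`. -/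
theorem le_mul_truncLog (T : ℕ) {t : ℝ} (ht : 0 ≤ t) :
    -(t * Real.logb 2 t) - 2 * ((2 : ℝ) ^ T)⁻¹ ≤ t * truncLog T t := by
  rcases ht.eq_or_lt with rfl | ht'
  · simp
  set u := ((2 : ℝ) ^ T)⁻¹ with hu
  have hu0 : 0 < u := by positivity
  rcases le_total u t with h | h
  · simp only [truncLog, ← hu, max_eq_left h]
    nlinarith
  · simp only [truncLog, ← hu, max_eq_right h]
    -- The difference is `t log₂ (u / t)`, and `log (u / t) ≤ u / t`.
    have h1 : Real.log u - Real.log t ≤ u / t := by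
      rw [← Real.log_div hu0.ne' ht'.ne']
      have := Real.log_le_sub_one_of_pos (div_pos hu0 ht')
      linarith
    have h2 : Real.logb 2 u - Real.logb 2 t ≤ 2 * (u / t) := by
      have hl : 0 < Real.log 2 := Real.log_pos one_lt_two
      have hl2 : 1 / 2 < Real.log 2 := by have := Real.log_two_gt_d9; linarith
      have h3 : 0 < u / t := div_pos hu0 ht'
      simp only [Real.logb]
      rw [← sub_div, div_le_iff₀ hl]
      nlinarith
    have h4 : t * (Real.logb 2 u - Real.logb 2 t) ≤ t * (2 * (u / t)) :=
      mul_le_mul_of_nonneg_left h2 ht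
    have h5 : t * (2 * (u / t)) = 2 * u := by field_simp
    nlinarith

theorem continuous_negMulLogb : Continuous fun t : ℝ => -(t * Real.logb 2 t) := by
  have h : (fun t : ℝ => -(t * Real.logb 2 t)) = fun t => -(t * Real.log t / Real.log 2) := by
    ext t
    simp [Real.logb, mul_div_assoc]
  rw [h]
  exact (Real.continuous_mul_log.div_const _).neg

end TruncLog

section Entropy

variable {A B ι : Type*}

/-- A form of Fatou's lemma: a strict lower bound for the limit sum is a strict lower bound for
some approximating sum. -/
theorem exists_lt_tsum_of_tendsto {κ : Type*} {F : ℕ → κ → ℝ≥0∞} {G : κ → ℝ≥0∞}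
    (h : ∀ k, Filter.Tendsto (fun T => F T k) Filter.atTop (nhds (G k))) {c : ℝ≥0∞}
    (hc : c < ∑' k, G k) : ∃ T, c < ∑' k, F T k := by
  rw [ENNReal.tsum_eq_iSup_sum] at hc
  obtain ⟨s, hs⟩ := lt_iSup_iff.1 hc
  have h1 := tendsto_finsetSum s fun k _ => h k
  obtain ⟨T, hT⟩ := ((tendsto_order.1 h1).1 c hs).exists
  exact ⟨T, hT.trans_le (ENNReal.sum_le_tsum s)⟩

/-- The expectation of `min (-log₂ ρ) T` in the state `ρ`; it tends to `H(ρ)` as `T → ∞`. -/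
def truncEntropy {E : Type*} [NormedAddCommGroup E] [InnerProductSpace ℂ E] [CompleteSpace E]
    (T : ℕ) (p : PMF A) (f : A → E) : ℝ≥0∞ :=
  expect p fun a => ENNReal.ofReal (⟪f a, fc (truncLog T) (avgState p f) (f a)⟫_ℂ).re

theorem tendsto_inner_fc_truncLog {E : Type*} [NormedAddCommGroup E] [InnerProductSpace ℂ E]
    [CompleteSpace E] (p : PMF A) {f : A → E} (hf : ∀ a, ‖f a‖ = 1) (v : E) :
    Filter.Tendsto
      (fun T => ENNReal.ofReal (⟪v, fc (fun t => t * truncLog T t) (avgState p f) v⟫_ℂ).re)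
      Filter.atTop
      (nhds (ENNReal.ofReal (⟪v, negMulLogOp (avgState p f) v⟫_ℂ).re)) := by
  refine (ENNReal.continuous_ofReal.tendsto _).comp ?_
  have h0 := avgState_nonneg p hf
  have h1 := re_inner_avgState_le p hf
  have hlow : ∀ T : ℕ, (⟪v, negMulLogOp (avgState p f) v⟫_ℂ).re -
      2 * ((2 : ℝ) ^ T)⁻¹ * ‖v‖ ^ 2 ≤
      (⟪v, fc (fun t => t * truncLog T t) (avgState p f) v⟫_ℂ).re := fun T => by
    refine le_trans (le_of_eq ?_) (re_inner_fc_le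
      (f := fun t => -(t * Real.logb 2 t) - 2 * ((2 : ℝ) ^ T)⁻¹)
      (continuous_negMulLogb.sub continuous_const) (continuous_id'.mul (continuous_truncLog T))
      h0 h1 (fun t ht => le_mul_truncLog T ht.1) v)
    rw [fc_sub continuous_negMulLogb continuous_const, sub_apply, inner_sub_right,
      fc_const (.of_nonneg h0), inner_smul_right, inner_self_eq_norm_sq_to_K, Complex.sub_re]
    congr 1
    simp [← Complex.ofReal_pow, ← Complex.ofReal_mul]
  have hup : ∀ T : ℕ, (⟪v, fc (fun t => t * truncLog T t) (avgState p f) v⟫_ℂ).re ≤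
      (⟪v, negMulLogOp (avgState p f) v⟫_ℂ).re := fun T =>
    re_inner_fc_le (continuous_id'.mul (continuous_truncLog T)) continuous_negMulLogb h0 h1
      (fun t ht => mul_truncLog_le T ht.1) v
  refine tendsto_of_tendsto_of_tendsto_of_le_of_le ?_ tendsto_const_nhds hlow hup
  have h2 : Filter.Tendsto (fun T : ℕ => ((2 : ℝ) ^ T)⁻¹) Filter.atTop (nhds 0) :=
    tendsto_inv_atTop_zero.comp (tendsto_pow_atTop_atTop_of_one_lt one_lt_two)
  simpa using ((h2.const_mul 2).mul_const (‖v‖ ^ 2)).const_sub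
    (⟪v, negMulLogOp (avgState p f) v⟫_ℂ).re

/-- The truncated entropies approximate the conditional entropy, also when it is infinite. -/
theorem exists_lt_truncEntropy (p : PMF A) (q : PMF B) {f : A → B → Hilb ι}
    (hf : ∀ a b, ‖f a b‖ = 1) {c : ℝ≥0∞}
    (hc : c < condEntropy p fun a => avgState q (f a)) :
    ∃ T, c < expect p fun a => truncEntropy T q (f a) := by
  classical
  obtain ⟨e, he⟩ : ∃ e : ι → Hilb ι, ∀ S : Op ι,
      posTrace S = ∑' i, ENNReal.ofReal (⟪e i, S (e i)⟫_ℂ).re := ⟨_, fun _ => rfl⟩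
  have h1 : ∀ T, expect p (fun a => truncEntropy T q (f a)) = ∑' z : A × ι, p z.1 *
      ENNReal.ofReal
        (⟪e z.2, fc (fun t => t * truncLog T t) (avgState q (f z.1)) (e z.2)⟫_ℂ).re := by
    intro T
    rw [ENNReal.tsum_prod (f := fun a i => p a * ENNReal.ofReal
      (⟪e i, fc (fun t => t * truncLog T t) (avgState q (f a)) (e i)⟫_ℂ).re)]
    refine tsum_congr fun a => ?_
    rw [ENNReal.tsum_mul_left, ← he, posTrace_fc_mul q (hf a) (continuous_truncLog T)
      fun t ht => truncLog_nonneg T ht.2]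
    rfl
  have h2 : condEntropy p (fun a => avgState q (f a)) = ∑' z : A × ι, p z.1 *
      ENNReal.ofReal (⟪e z.2, negMulLogOp (avgState q (f z.1)) (e z.2)⟫_ℂ).re := by
    rw [ENNReal.tsum_prod (f := fun a i => p a * ENNReal.ofReal
      (⟪e i, negMulLogOp (avgState q (f a)) (e i)⟫_ℂ).re)]
    refine tsum_congr fun a => ?_
    rw [ENNReal.tsum_mul_left, ← he]
    rfl
  simp only [h1]
  rw [h2] at hc
  have h3 := fun z : A × ι => tendsto_inner_fc_truncLog q (hf z.1) (e z.2)
  have h4 := fun z : A × ι => ENNReal.Tendsto.const_mul (h3 z) (Or.inr (p.apply_ne_top z.1))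
  exact exists_lt_tsum_of_tendsto h4 hc

/-- The vectors `2^{G/2} f a`, with `G` the truncated `-log₂ ρ`, satisfy Bessel's inequality
because `2^G ≤ ρ⁻¹`. -/
theorem expect_inner_exp_le {E : Type*} [NormedAddCommGroup E] [InnerProductSpace ℂ E]
    [CompleteSpace E] (p : PMF A) {f : A → E} (hf : ∀ a, ‖f a‖ = 1) (T : ℕ) (χ : E) :
    expect p (fun a => ‖⟪NormedSpace.exp (((Real.log 2 / 2 : ℝ) : ℂ) •
      fc (truncLog T) (avgState p f)) (f a), χ⟫_ℂ‖ₑ ^ 2) ≤ 1 * ‖χ‖ₑ ^ 2 := by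
  have hs := isSelfAdjoint_avgState p hf
  have hc := continuous_truncLog T
  rw [fc_exp hs hc, expect_inner_fc p hf (by fun_prop), one_mul, ← ofReal_norm,
    ← ENNReal.ofReal_pow (norm_nonneg _)]
  refine ENNReal.ofReal_le_ofReal ?_
  refine (re_inner_fc_le (g := fun _ => 1) (by fun_prop) (by fun_prop) (avgState_nonneg p hf)
    (re_inner_avgState_le p hf) (fun t ht => ?_) χ).trans_eq ?_
  · have h2 : Real.exp (Real.log 2 / 2 * truncLog T t) * Real.exp (Real.log 2 / 2 * truncLog T t) =
        (max t ((2 : ℝ) ^ T)⁻¹)⁻¹ := by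
      rw [← Real.exp_add, ← exp_truncLog]
      ring_nf
    have h0 : 0 < max t ((2 : ℝ) ^ T)⁻¹ := lt_max_of_lt_right (by positivity)
    calc _ = t * (Real.exp (Real.log 2 / 2 * truncLog T t) *
          Real.exp (Real.log 2 / 2 * truncLog T t)) := by ring
      _ ≤ 1 := by
          rw [h2, ← div_eq_mul_inv, div_le_one h0]
          exact le_max_left _ _
  · rw [fc_const hs, Complex.ofReal_one, one_smul]
    exact inner_self_eq_norm_sq (𝕜 := ℂ) χ

end Entropy

/-! ### Min-entropy -/

section MinEntropy

variable {A ι : Type*} (p : PMF A) {f : A → Hilb ι}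

/-- The infimum in the definition of the min-entropy is positive and attained, so that no junk value
of `sInf` or `logb` occurs. -/
theorem exists_minEntropy_eq (hf : ∀ a, ‖f a‖ = 1) :
    ∃ c : ℝ, 0 < c ∧ c ≤ 1 ∧ minEntropy (avgState p f) = -Real.logb 2 c ∧
      ∀ v, (⟪v, avgState p f v⟫_ℂ).re ≤ c * ‖v‖ ^ 2 := by
  set S : Set ℝ := {c : ℝ | avgState p f ≤ (c : ℂ) • (1 : Op ι)} with hS
  have hmem : ∀ c, c ∈ S ↔ ∀ v, (⟪v, avgState p f v⟫_ℂ).re ≤ c * ‖v‖ ^ 2 :=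
    avgState_le_smul_one_iff p hf
  have h1 : (1 : ℝ) ∈ S := (hmem 1).2 (re_inner_avgState_le p hf)
  obtain ⟨a, ha⟩ := p.support_nonempty
  have hpa : 0 < (p a).toReal := ENNReal.toReal_pos ((p.mem_support_iff a).1 ha) (p.apply_ne_top a)
  have hlow : ∀ c ∈ S, (p a).toReal ≤ c := by
    intro c hc
    have h2 := (hmem c).1 hc (f a)
    have h3 := le_hasSum (hasSum_re_inner_avgState p hf (f a)) a fun b _ => by positivity
    have h4 : ‖⟪f a, f a⟫_ℂ‖ = 1 := by simp [inner_self_eq_norm_sq_to_K, hf]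
    rw [h4] at h3
    rw [hf] at h2
    linarith
  have hbdd : BddBelow S := ⟨_, hlow⟩
  refine ⟨sInf S, hpa.trans_le (le_csInf ⟨1, h1⟩ hlow), csInf_le hbdd h1, rfl, fun v => ?_⟩
  rcases eq_or_ne v 0 with rfl | hv
  · simp
  have hv' : 0 < ‖v‖ ^ 2 := by positivity
  rw [← div_le_iff₀ hv']
  refine le_csInf ⟨1, h1⟩ fun c hc => ?_
  rw [div_le_iff₀ hv']
  exact (hmem c).1 hc v

theorem minEntropy_nonneg (hf : ∀ a, ‖f a‖ = 1) : 0 ≤ minEntropy (avgState p f) := by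
  obtain ⟨c, hc0, hc1, h, -⟩ := exists_minEntropy_eq p hf
  rw [h]
  have := Real.logb_nonpos one_lt_two hc0.le hc1
  linarith

/-- A state of large min-entropy has small overlap with every vector. -/
theorem expect_inner_le_of_le_minEntropy (hf : ∀ a, ‖f a‖ = 1) {R : ℝ}
    (hR : R ≤ minEntropy (avgState p f)) (χ : Hilb ι) :
    expect p (fun a => ‖⟪f a, χ⟫_ℂ‖ₑ ^ 2) ≤ ENNReal.ofReal (2 ^ (-R)) * ‖χ‖ₑ ^ 2 := by
  obtain ⟨c, hc0, hc1, h, hle⟩ := exists_minEntropy_eq p hf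
  rw [← ofReal_inner_avgState p hf, ← ofReal_norm, ← ENNReal.ofReal_pow (norm_nonneg _),
    ← ENNReal.ofReal_mul (by positivity)]
  refine ENNReal.ofReal_le_ofReal ((hle χ).trans ?_)
  gcongr
  rw [← Real.logb_le_iff_le_rpow one_lt_two hc0]
  linarith

/-- The inequality `H_min ≤ H`: from `ρ ≤ 2^{-m}` it follows that `m ρ ≤ -ρ log₂ ρ`, and `m ρ` has
trace `m`. -/
theorem ofReal_minEntropy_le (hf : ∀ a, ‖f a‖ = 1) :
    ENNReal.ofReal (minEntropy (avgState p f)) ≤ vnEntropy (avgState p f) := by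
  obtain ⟨c, hc0, hc1, h, hle⟩ := exists_minEntropy_eq p hf
  have hm := minEntropy_nonneg p hf
  set m := minEntropy (avgState p f)
  have h1 : posTrace (fc (fun t => t * m) (avgState p f)) = ENNReal.ofReal m := by
    rw [posTrace_fc_mul p hf continuous_const fun _ _ => hm]
    have h2 : ∀ a, (⟪f a, fc (fun _ => m) (avgState p f) (f a)⟫_ℂ).re = m := fun a => by
      rw [fc_const (isSelfAdjoint_avgState p hf), inner_smul_right, inner_self_eq_norm_sq_to_K, hf]
      simp
    simp [h2, expect_const]
  rw [← h1]
  refine ENNReal.tsum_le_tsum fun i => ENNReal.ofReal_le_ofReal ?_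
  refine re_inner_fc_le (by fun_prop) continuous_negMulLogb (avgState_nonneg p hf) hle
    (fun t ht => ?_) _
  rcases ht.1.eq_or_lt with rfl | ht0
  · simp
  have := Real.logb_le_logb_of_le one_lt_two ht0 ht.2
  rw [h]
  nlinarith [ht.1]

theorem ofReal_condMinEntropy_le {A' : Type*} (q : PMF A') {f : A' → A → Hilb ι}
    (hf : ∀ x a, ‖f x a‖ = 1) :
    ENNReal.ofReal (condMinEntropy fun x => avgState p (f x)) ≤
      condEntropy q fun x => avgState p (f x) := by
  have hbdd : BddBelow (Set.range fun x => minEntropy (avgState p (f x))) := by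
    refine ⟨0, ?_⟩
    rintro _ ⟨x, rfl⟩
    exact minEntropy_nonneg p (hf x)
  refine (expect_const q _).symm.trans_le (expect_mono q fun x => ?_)
  exact (ENNReal.ofReal_le_ofReal (ciInf_le hbdd x)).trans (ofReal_minEntropy_le p (hf x))

theorem condMinEntropy_nonneg {A' : Type*} {f : A' → A → Hilb ι} (hf : ∀ x a, ‖f x a‖ = 1) :
    0 ≤ condMinEntropy fun x => avgState p (f x) :=
  Real.iInf_nonneg fun x => minEntropy_nonneg p (hf x)

theorem condMinEntropy_le {A' : Type*} {f : A' → A → Hilb ι} (hf : ∀ x a, ‖f x a‖ = 1) (x : A') :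
    condMinEntropy (fun x => avgState p (f x)) ≤ minEntropy (avgState p (f x)) :=
  ciInf_le ⟨0, by rintro _ ⟨x, rfl⟩; exact minEntropy_nonneg p (hf x)⟩ x

end MinEntropy

/-! ### Entropic smoothing of product states -/

theorem isSelfAdjoint_sub_smul_one {E : Type*} [NormedAddCommGroup E] [InnerProductSpace ℂ E]
    [CompleteSpace E] {S : E →L[ℂ] E} (hS : IsSelfAdjoint S) (m : ℝ) :
    IsSelfAdjoint (S - (m : ℂ) • (1 : E →L[ℂ] E)) := by
  have h : S - (m : ℂ) • (1 : E →L[ℂ] E) = fc (fun t => t - m) S := by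
    ext v
    rw [fc_sub continuous_id' continuous_const, fc_id hS, sub_apply, sub_apply, fc_const hS]
    rfl
  rw [h]
  exact isSelfAdjoint_fc _ _

section Variance

variable {ι : Type*} {n : ℕ}

theorem inner_tensorVec_update {i j : Fin n} (hij : i ≠ j) (v : Fin n → Hilb ι)
    (hv : ∀ i, ‖v i‖ = 1) (a b : Hilb ι) :
    ⟪tensorVec (Function.update v i a), tensorVec (Function.update v j b)⟫_ℂ =
      ⟪a, v i⟫_ℂ * ⟪v j, b⟫_ℂ := by
  rw [inner_tensorVec, Finset.prod_eq_mul i j hij]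
  · simp [hij, hij.symm]
  · intro k _ hk
    simp [hk.1, hk.2, inner_self_eq_norm_sq_to_K, hv]
  · simp
  · simp

theorem inner_tensorVec_update_self (i : Fin n) (v : Fin n → Hilb ι)
    (hv : ∀ i, ‖v i‖ = 1) (a b : Hilb ι) :
    ⟪tensorVec (Function.update v i a), tensorVec (Function.update v i b)⟫_ℂ = ⟪a, b⟫_ℂ := by
  rw [inner_tensorVec, Finset.prod_eq_single i]
  · simp
  · intro k _ hk
    simp [hk, inner_self_eq_norm_sq_to_K, hv]
  · simp

/-- On a product state the cross terms of a sum of one-site observables factorize. -/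
theorem norm_sq_sum_siteHom_le (G : Fin n → Op ι) (hG : ∀ i, IsSelfAdjoint (G i))
    (v : Fin n → Hilb ι) (hv : ∀ i, ‖v i‖ = 1) {c : ℝ} (hc : ∀ i, ‖G i (v i)‖ ≤ c) :
    ‖(∑ i, siteHom ι i (G i)) (tensorVec v)‖ ^ 2 ≤
      (∑ i, (⟪v i, G i (v i)⟫_ℂ).re) ^ 2 + n * c ^ 2 := by
  set g : Fin n → ℝ := fun i => (⟪v i, G i (v i)⟫_ℂ).re with hg
  set w : Fin n → Hilb (Fin n → ι) := fun i => tensorVec (Function.update v i (G i (v i))) with hw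
  have hsum : (∑ i, siteHom ι i (G i)) (tensorVec v) = ∑ i, w i := by
    rw [sum_apply]
    exact Finset.sum_congr rfl fun i _ => siteHom_tensorVec i (G i) v
  have hreal : ∀ i, ⟪v i, G i (v i)⟫_ℂ = (g i : ℂ) := fun i => by
    have h1 : (starRingEnd ℂ) ⟪v i, G i (v i)⟫_ℂ = ⟪v i, G i (v i)⟫_ℂ := by
      rw [inner_conj_symm, inner_selfAdjoint (hG i)]
    exact (Complex.conj_eq_iff_re.1 h1).symm
  have hij : ∀ i j, (⟪w i, w j⟫_ℂ).re ≤ g i * g j + if i = j then c ^ 2 else 0 := by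
    intro i j
    by_cases h : i = j
    · subst h
      simp only [hw, inner_tensorVec_update_self i v hv, if_true]
      have h1 : (⟪G i (v i), G i (v i)⟫_ℂ).re = ‖G i (v i)‖ ^ 2 := inner_self_eq_norm_sq (𝕜 := ℂ) _
      rw [h1]
      have := pow_le_pow_left₀ (norm_nonneg _) (hc i) 2
      nlinarith [mul_self_nonneg (g i)]
    · simp only [hw, inner_tensorVec_update h v hv, if_neg h, inner_selfAdjoint (hG i), hreal]
      simp
  calc ‖(∑ i, siteHom ι i (G i)) (tensorVec v)‖ ^ 2 = (⟪∑ i, w i, ∑ i, w i⟫_ℂ).re := by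
        rw [hsum]
        exact (inner_self_eq_norm_sq (𝕜 := ℂ) _).symm
    _ = ∑ i, ∑ j, (⟪w i, w j⟫_ℂ).re := by
        simp only [sum_inner, inner_sum, Complex.re_sum]
        exact Finset.sum_comm
    _ ≤ ∑ i, ∑ j, (g i * g j + if i = j then c ^ 2 else 0) :=
        Finset.sum_le_sum fun i _ => Finset.sum_le_sum fun j _ => hij i j
    _ = _ := by
        simp [Finset.sum_add_distrib, sq, Finset.sum_mul_sum]

end Variance

section Moments

variable {A : Type*} (p : PMF A)

theorem expect_ofReal_of_hasSum {h : A → ℝ} {m : ℝ} (h0 : ∀ a, 0 ≤ h a)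
    (hs : HasSum (fun a => (p a).toReal * h a) m) :
    expect p (fun a => ENNReal.ofReal (h a)) = ENNReal.ofReal m := by
  rw [← hs.tsum_eq, ENNReal.ofReal_tsum_of_nonneg
    (fun a => mul_nonneg ENNReal.toReal_nonneg (h0 a)) hs.summable]
  refine tsum_congr fun a => ?_
  rw [ENNReal.ofReal_mul ENNReal.toReal_nonneg, ENNReal.ofReal_toReal (p.apply_ne_top a)]

theorem hasSum_of_expect_ofReal {h : A → ℝ} (h0 : ∀ a, 0 ≤ h a)
    (hs : expect p (fun a => ENNReal.ofReal (h a)) ≠ ∞) :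
    HasSum (fun a => (p a).toReal * h a)
      (expect p fun a => ENNReal.ofReal (h a)).toReal := by
  rw [expect, ENNReal.tsum_toReal_eq (ENNReal.ne_top_of_tsum_ne_top hs)]
  refine (ENNReal.hasSum_toReal hs).congr_fun fun a => ?_
  rw [ENNReal.toReal_mul, ENNReal.toReal_ofReal (h0 a)]

/-- A variable in `[0, c]` minus its mean has second moment at most `c²`, about any point `s`
off the mean. -/
theorem expect_sq_add_sub_mean_le {h : A → ℝ} {c : ℝ} (h0 : ∀ a, 0 ≤ h a) (hc : ∀ a, h a ≤ c)
    {m : ℝ} (hm0 : 0 ≤ m) (hmc : m ≤ c) (hs : HasSum (fun a => (p a).toReal * h a) m) (s : ℝ) :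
    expect p (fun a => ENNReal.ofReal ((s + (h a - m)) ^ 2)) ≤
      ENNReal.ofReal (s ^ 2) + ENNReal.ofReal (c ^ 2) := by
  have hle : ∀ a, (s + (h a - m)) ^ 2 ≤ s ^ 2 + 2 * s * (h a - m) + c ^ 2 := fun a => by
    have : (h a - m) ^ 2 ≤ c ^ 2 := by
      rw [sq_le_sq, abs_le, abs_of_nonneg (hm0.trans hmc)]
      constructor <;> linarith [h0 a, hc a]
    linarith
  have h1 : HasSum (fun a => (p a).toReal * (s ^ 2 + 2 * s * (h a - m) + c ^ 2))
      (s ^ 2 + c ^ 2) := by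
    have h2 := ((hasSum_toReal p).mul_left (s ^ 2 - 2 * s * m + c ^ 2)).add (hs.mul_left (2 * s))
    have h3 : (s ^ 2 - 2 * s * m + c ^ 2) * 1 + 2 * s * m = s ^ 2 + c ^ 2 := by ring
    rw [h3] at h2
    exact h2.congr_fun fun a => by ring
  refine (expect_mono p fun a => ENNReal.ofReal_le_ofReal (hle a)).trans_eq ?_
  rw [expect_ofReal_of_hasSum p (fun a => (sq_nonneg _).trans (hle a)) h1,
    ENNReal.ofReal_add (sq_nonneg _) (sq_nonneg _)]

end Moments

section Smoothing

/-- The cut-off function that vanishes up to `n K` and equals `1` from `n μ` on. -/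
def cutoff (n : ℕ) (K μ s : ℝ) : ℝ := max 0 (min 1 ((s - n * K) / (n * (μ - K))))

theorem continuous_cutoff (n : ℕ) (K μ : ℝ) : Continuous (cutoff n K μ) := by
  unfold cutoff
  fun_prop

theorem cutoff_nonneg (n : ℕ) (K μ s : ℝ) : 0 ≤ cutoff n K μ s := le_max_left _ _

theorem cutoff_le_one (n : ℕ) (K μ s : ℝ) : cutoff n K μ s ≤ 1 :=
  max_le zero_le_one (min_le_left _ _)

theorem cutoff_eq_zero {n : ℕ} {K μ s : ℝ} (h : K < μ) (hs : s ≤ n * K) :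
    cutoff n K μ s = 0 := by
  refine max_eq_left ((min_le_right _ _).trans ?_)
  exact div_nonpos_of_nonpos_of_nonneg (by linarith) (mul_nonneg n.cast_nonneg (by linarith))

theorem abs_one_sub_cutoff_le {n : ℕ} (hn : 0 < n) {K μ : ℝ} (h : K < μ) (s : ℝ) :
    |1 - cutoff n K μ s| ≤ |(s - n * μ) * (n * (μ - K))⁻¹| := by
  have hd : 0 < n * (μ - K) := mul_pos (by exact_mod_cast hn) (by linarith)
  rw [abs_of_nonneg (by linarith [cutoff_le_one n K μ s])]
  rcases le_total (n * μ) s with hs | hs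
  · have : 1 ≤ (s - n * K) / (n * (μ - K)) := by
      rw [le_div_iff₀ hd]
      linarith
    have h1 : cutoff n K μ s = 1 := by simp [cutoff, min_eq_left this]
    rw [h1, sub_self]
    positivity
  · have h1 : (s - n * K) / (n * (μ - K)) ≤ cutoff n K μ s := by
      refine le_max_of_le_right (le_min ?_ le_rfl)
      rw [div_le_one hd]
      linarith
    refine le_trans ?_ (neg_le_abs _)
    have h2 : (s - n * K) / (n * (μ - K)) = 1 + (s - n * μ) * (n * (μ - K))⁻¹ := by
      rw [div_eq_iff hd.ne', add_mul, mul_assoc, inv_mul_cancel₀ hd.ne']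
      ring
    linarith

variable {A B ι : Type*} {n : ℕ}

/-- The total observable `∑ᵢ Gᵢ`. -/
def siteSum (G : Fin n → Op ι) : Op (Fin n → ι) := ∑ i, siteHom ι i (G i)

theorem isSelfAdjoint_siteSum {G : Fin n → Op ι} (hG : ∀ i, IsSelfAdjoint (G i)) :
    IsSelfAdjoint (siteSum G) :=
  isSelfAdjoint_sum _ fun i _ => (hG i).map (siteHom ι i)

theorem exp_smul_siteSum_tensorVec (c : ℂ) (G : Fin n → Op ι) (v : Fin n → Hilb ι) :
    NormedSpace.exp (c • siteSum G) (tensorVec v) =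
      tensorVec fun i => NormedSpace.exp (c • G i) (v i) := by
  have h : c • siteSum G = ∑ i ∈ Finset.univ, siteHom ι i (c • G i) := by
    simp only [siteSum, Finset.smul_sum, map_smul]
  rw [h, exp_sum_siteHom]
  simp

theorem siteSum_sub_apply (G : Fin n → Op ι) (m : ℝ) (v : Hilb (Fin n → ι)) :
    (∑ i, siteHom ι i (G i - (m : ℂ) • (1 : Op ι))) v = siteSum G v - ((n * m : ℝ) : ℂ) • v := by
  simp only [map_sub, map_smul, map_one, Finset.sum_sub_distrib, sub_apply, siteSum]
  congr 1
  rw [sum_apply]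
  simp only [smul_apply, one_apply_eq_self]
  rw [Finset.sum_const, Finset.card_univ, Fintype.card_fin, ← Nat.cast_smul_eq_nsmul ℂ, smul_smul]
  push_cast
  rfl

/-- The smooth replacement of the conditionally typical projection. -/
def smoothing (K μ : ℝ) (G : Fin n → Op ι) : Op (Fin n → ι) := fc (cutoff n K μ) (siteSum G)

theorem norm_smoothing_apply_le (K μ : ℝ) {G : Fin n → Op ι} (hG : ∀ i, IsSelfAdjoint (G i))
    (v : Hilb (Fin n → ι)) : ‖smoothing K μ G v‖ ≤ ‖v‖ := by
  refine (norm_fc_apply_le (g := fun _ => 1) (continuous_cutoff n K μ) continuous_const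
    (fun t => ?_) v).trans_eq ?_
  · rw [abs_of_nonneg (cutoff_nonneg _ _ _ _), abs_one]
    exact cutoff_le_one _ _ _ _
  · rw [fc_const (isSelfAdjoint_siteSum hG)]
    simp

theorem norm_sub_smoothing_le (hn : 0 < n) {K μ : ℝ} (h : K < μ) {G : Fin n → Op ι}
    (hG : ∀ i, IsSelfAdjoint (G i)) (v : Hilb (Fin n → ι)) :
    ‖v - smoothing K μ G v‖ ≤
      ‖siteSum G v - ((n * μ : ℝ) : ℂ) • v‖ * (n * (μ - K))⁻¹ := by
  have hS := isSelfAdjoint_siteSum hG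
  have hd : 0 < n * (μ - K) := mul_pos (by exact_mod_cast hn) (by linarith)
  have hc := continuous_cutoff n K μ
  have h1 : v - smoothing K μ G v = fc (fun t => 1 - cutoff n K μ t) (siteSum G) v := by
    rw [fc_sub continuous_const hc, sub_apply, fc_const hS]
    simp [smoothing]
  have h2 : fc (fun t => (t - n * μ) * (n * (μ - K))⁻¹) (siteSum G) v =
      (((n * (μ - K))⁻¹ : ℝ) : ℂ) • (siteSum G v - ((n * μ : ℝ) : ℂ) • v) := by
    rw [fc_mul (by fun_prop) (by fun_prop), fc_const hS, fc_sub continuous_id' continuous_const,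
      fc_id hS, sub_apply, fc_const hS, map_smul, smul_sub]
    congr 1
    exact smul_comm _ _ _
  rw [h1]
  refine (norm_fc_apply_le (by fun_prop) (by fun_prop) (abs_one_sub_cutoff_le hn h) v).trans_eq ?_
  rw [h2, norm_smul, Complex.norm_real, Real.norm_of_nonneg (by positivity), mul_comm]

theorem norm_exp_smoothing_le {K μ : ℝ} (h : K < μ) {G : Fin n → Op ι}
    (hG : ∀ i, IsSelfAdjoint (G i)) {c : ℝ} (hc : 0 ≤ c) (v : Hilb (Fin n → ι)) :
    ‖NormedSpace.exp (((-c : ℝ) : ℂ) • siteSum G) (smoothing K μ G v)‖ ≤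
      Real.exp (-c * (n * K)) * ‖v‖ := by
  have hS := isSelfAdjoint_siteSum hG
  have hcut := continuous_cutoff n K μ
  have h1 : NormedSpace.exp (((-c : ℝ) : ℂ) • siteSum G) =
      fc (fun t => Real.exp (-c * t)) (siteSum G) := by
    rw [← fc_exp hS continuous_id', fc_id hS]
  rw [h1, smoothing, ← fc_mul (by fun_prop) hcut]
  refine (norm_fc_apply_le (g := fun _ => Real.exp (-c * (n * K))) (by fun_prop) (by fun_prop)
    (fun t => ?_) v).trans_eq ?_
  · rw [abs_of_nonneg (mul_nonneg (Real.exp_pos _).le (cutoff_nonneg _ _ _ _)),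
      abs_of_pos (Real.exp_pos _)]
    rcases le_total t (n * K) with ht | ht
    · rw [cutoff_eq_zero h ht, mul_zero]
      positivity
    · refine (mul_le_of_le_one_right (Real.exp_pos _).le (cutoff_le_one _ _ _ _)).trans ?_
      rw [Real.exp_le_exp]
      nlinarith
  · rw [fc_const hS, norm_smul, Complex.norm_real, Real.norm_of_nonneg (Real.exp_pos _).le]

/-- The observable `min (-log₂ ρₐ) T` of the average state `ρₐ` of the ensemble `f a`. -/
def logOp (T : ℕ) (q : PMF B) (f : A → B → Hilb ι) (a : A) : Op ι :=
  fc (truncLog T) (avgState q (f a))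

theorem exp_neg_exp_logOp (T : ℕ) (q : PMF B) {f : A → B → Hilb ι} (hf : ∀ a b, ‖f a b‖ = 1)
    (a : A) (c : ℝ) (v : Hilb ι) :
    NormedSpace.exp (((-c : ℝ) : ℂ) • logOp T q f a)
      (NormedSpace.exp ((c : ℂ) • logOp T q f a) v) = v := by
  have hs := isSelfAdjoint_avgState q (hf a)
  have hc := continuous_truncLog T
  have h1 : (fun t => Real.exp (-c * truncLog T t) * Real.exp (c * truncLog T t)) =
      fun _ => (1 : ℝ) := by
    ext t
    rw [← Real.exp_add]
    simp
  rw [logOp, fc_exp hs hc, fc_exp hs hc, ← fc_mul (by fun_prop) (by fun_prop), h1, fc_const hs]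
  simp

/-- The smoothing operator cuts the spectrum of the average state at `2^{-nK}`. -/
theorem expect_inner_smoothing_le (T : ℕ) (q : PMF B) {f : A → B → Hilb ι}
    (hf : ∀ a b, ‖f a b‖ = 1) {K μ : ℝ} (h : K < μ) (a : Fin n → A) (χ : Hilb (Fin n → ι)) :
    expect (iid q n) (fun b => ‖⟪tensorVec fun i => f (a i) (b i),
      smoothing K μ (fun i => logOp T q f (a i)) χ⟫_ℂ‖ₑ ^ 2) ≤
      ENNReal.ofReal (2 ^ (-(n * K))) * ‖χ‖ₑ ^ 2 := by
  set c : ℝ := Real.log 2 / 2 with hcdef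
  have hc : 0 ≤ c := by have := Real.log_pos one_lt_two; positivity
  set G : Fin n → Op ι := fun i => logOp T q f (a i) with hGdef
  have hG : ∀ i, IsSelfAdjoint (G i) := fun i => isSelfAdjoint_fc _ _
  have hexp : IsSelfAdjoint (NormedSpace.exp (((-c : ℝ) : ℂ) • siteSum G)) := by
    have h1 := fc_exp (isSelfAdjoint_siteSum hG) continuous_id' (-c)
    rw [fc_id (isSelfAdjoint_siteSum hG)] at h1
    rw [h1]
    exact isSelfAdjoint_fc _ _
  have hφ : ∀ b : Fin n → B, (tensorVec fun i => f (a i) (b i)) =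
      NormedSpace.exp (((-c : ℝ) : ℂ) • siteSum G)
        (tensorVec fun i => NormedSpace.exp ((c : ℂ) • G i) (f (a i) (b i))) := fun b => by
    rw [exp_smul_siteSum_tensorVec]
    congr 1
    ext1 i
    exact (exp_neg_exp_logOp T q hf (a i) c _).symm
  -- The exponential weight is moved from the outputs to the smoothed vector; the reweighted
  -- outputs satisfy Bessel's inequality.
  simp only [hφ, inner_selfAdjoint hexp]
  refine (expect_inner_tensorVec_le q
    (fun a b => NormedSpace.exp ((c : ℂ) • logOp T q f a) (f a b)) 1
    (fun a χ => expect_inner_exp_le q (hf a) T χ) a _).trans ?_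
  rw [one_pow, one_mul, ← ofReal_norm, ← ofReal_norm, ← ENNReal.ofReal_pow (norm_nonneg _),
    ← ENNReal.ofReal_pow (norm_nonneg _), ← ENNReal.ofReal_mul (by positivity)]
  refine ENNReal.ofReal_le_ofReal ?_
  refine (pow_le_pow_left₀ (norm_nonneg _) (norm_exp_smoothing_le h hG hc χ) 2).trans_eq ?_
  rw [mul_pow]
  congr 1
  rw [← Real.exp_nat_mul, Real.rpow_def_of_pos two_pos, hcdef]
  congr 1
  push_cast
  ring

theorem re_inner_fc_const (q : PMF B) {f : A → B → Hilb ι} (hf : ∀ a b, ‖f a b‖ = 1) (a : A)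
    (b : B) (c : ℝ) : (⟪f a b, fc (fun _ => c) (avgState q (f a)) (f a b)⟫_ℂ).re = c := by
  rw [fc_const (isSelfAdjoint_avgState q (hf a)), inner_smul_right, inner_self_eq_norm_sq_to_K, hf]
  simp

theorem re_inner_logOp_nonneg (T : ℕ) (q : PMF B) {f : A → B → Hilb ι} (hf : ∀ a b, ‖f a b‖ = 1)
    (a : A) (b : B) : 0 ≤ (⟪f a b, logOp T q f a (f a b)⟫_ℂ).re :=
  (re_inner_fc_const q hf a b 0).symm.trans_le
    (re_inner_fc_le continuous_const (continuous_truncLog T) (avgState_nonneg q (hf a))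
      (re_inner_avgState_le q (hf a)) (fun _ ht => truncLog_nonneg T ht.2) _)

theorem re_inner_logOp_le (T : ℕ) (q : PMF B) {f : A → B → Hilb ι} (hf : ∀ a b, ‖f a b‖ = 1)
    (a : A) (b : B) : (⟪f a b, logOp T q f a (f a b)⟫_ℂ).re ≤ T :=
  (re_inner_fc_le (continuous_truncLog T) continuous_const (avgState_nonneg q (hf a))
    (re_inner_avgState_le q (hf a)) (fun t _ => truncLog_le T t) _).trans_eq
    (re_inner_fc_const q hf a b T)

theorem norm_logOp_sub_apply_le (T : ℕ) (q : PMF B) {f : A → B → Hilb ι}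
    (hf : ∀ a b, ‖f a b‖ = 1) (a : A) (b : B) {μ : ℝ} (hμ0 : 0 ≤ μ) (hμT : μ ≤ T) :
    ‖(logOp T q f a - (μ : ℂ) • (1 : Op ι)) (f a b)‖ ≤ T := by
  have h0 := avgState_nonneg q (hf a)
  have hcont := continuous_truncLog T
  have h3 : (logOp T q f a - (μ : ℂ) • (1 : Op ι)) (f a b) =
      fc (fun t => truncLog T t - μ) (avgState q (f a)) (f a b) := by
    rw [fc_sub hcont continuous_const, sub_apply, sub_apply, fc_const (.of_nonneg h0)]
    rfl
  rw [h3]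
  refine le_of_sq_le_sq ?_ T.cast_nonneg
  rw [norm_sq_fc_apply (by fun_prop)]
  refine (re_inner_fc_le (g := fun _ => (T : ℝ) ^ 2) (by fun_prop) (by fun_prop) h0
    (re_inner_avgState_le q (hf a)) (fun t ht => ?_) _).trans_eq (re_inner_fc_const q hf a b _)
  have h5 := truncLog_nonneg T ht.2
  have h6 := truncLog_le T t
  rw [← sq, sq_le_sq, abs_le, abs_of_nonneg (hμ0.trans hμT)]
  constructor <;> linarith

theorem re_inner_logOp_sub_apply (T : ℕ) (q : PMF B) {f : A → B → Hilb ι}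
    (hf : ∀ a b, ‖f a b‖ = 1) (a : A) (b : B) (μ : ℝ) :
    (⟪f a b, (logOp T q f a - (μ : ℂ) • (1 : Op ι)) (f a b)⟫_ℂ).re =
      (⟪f a b, logOp T q f a (f a b)⟫_ℂ).re - μ := by
  rw [sub_apply, inner_sub_right, Complex.sub_re]
  congr 1
  rw [smul_apply, one_apply_eq_self, inner_smul_right, inner_self_eq_norm_sq_to_K, hf]
  simp

theorem norm_sub_smoothing_sq_le (T : ℕ) (q : PMF B) {f : A → B → Hilb ι}
    (hf : ∀ a b, ‖f a b‖ = 1) {K μ : ℝ} (h : K < μ) (hμ0 : 0 ≤ μ) (hμT : μ ≤ T) (hn : 0 < n)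
    (a : Fin n → A) (b : Fin n → B) :
    ‖(tensorVec fun i => f (a i) (b i)) - smoothing K μ (fun i => logOp T q f (a i))
      (tensorVec fun i => f (a i) (b i))‖ ^ 2 ≤
      ((∑ i, ((⟪f (a i) (b i), logOp T q f (a i) (f (a i) (b i))⟫_ℂ).re - μ)) ^ 2 +
        n * (T : ℝ) ^ 2) * (n * (μ - K))⁻¹ ^ 2 := by
  have hG : ∀ i, IsSelfAdjoint (logOp T q f (a i)) := fun i => isSelfAdjoint_fc _ _
  have hG' : ∀ i, IsSelfAdjoint (logOp T q f (a i) - (μ : ℂ) • (1 : Op ι)) := fun i =>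
    isSelfAdjoint_sub_smul_one (hG i) μ
  have h1 := norm_sub_smoothing_le hn h hG (tensorVec fun i => f (a i) (b i))
  rw [← siteSum_sub_apply] at h1
  have h4 := norm_sq_sum_siteHom_le (fun i => logOp T q f (a i) - (μ : ℂ) • (1 : Op ι)) hG'
    (fun i => f (a i) (b i)) (fun i => hf _ _) fun i =>
      norm_logOp_sub_apply_le T q hf (a i) (b i) hμ0 hμT
  simp only [re_inner_logOp_sub_apply T q hf] at h4
  refine (pow_le_pow_left₀ (norm_nonneg _) h1 2).trans ?_
  rw [mul_pow]
  exact mul_le_mul_of_nonneg_right h4 (sq_nonneg _)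

/-- The smoothing operator hardly disturbs typical product states (Chebyshev's inequality). -/
theorem expect_sub_smoothing_le (T : ℕ) (p : PMF A) (q : PMF B) {f : A → B → Hilb ι}
    (hf : ∀ a b, ‖f a b‖ = 1) {K μ : ℝ} (h : K < μ)
    (hμ : μ = (expect p fun a => truncEntropy T q (f a)).toReal) (hn : 0 < n) :
    expect (iid p n) (fun a => expect (iid q n) fun b =>
      ‖(tensorVec fun i => f (a i) (b i)) - smoothing K μ (fun i => logOp T q f (a i))
        (tensorVec fun i => f (a i) (b i))‖ₑ ^ 2) ≤
      ENNReal.ofReal (2 * T ^ 2 / (n * (μ - K) ^ 2)) := by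
  set g : A × B → ℝ := fun z => (⟪f z.1 z.2, logOp T q f z.1 (f z.1 z.2)⟫_ℂ).re with hg
  have hg0 : ∀ z, 0 ≤ g z := fun z => re_inner_logOp_nonneg T q hf _ _
  have hgT : ∀ z, g z ≤ T := fun z => re_inner_logOp_le T q hf _ _
  have hmean : expect (prodPMF p q) (fun z => ENNReal.ofReal (g z)) =
      expect p fun a => truncEntropy T q (f a) := expect_prodPMF _ _ _
  have hle : expect (prodPMF p q) (fun z => ENNReal.ofReal (g z)) ≤ ENNReal.ofReal T :=
    expect_le_const _ fun z => ENNReal.ofReal_le_ofReal (hgT z)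
  have hsum := hasSum_of_expect_ofReal (prodPMF p q) hg0
    (ne_top_of_le_ne_top ENNReal.ofReal_ne_top hle)
  rw [hmean, ← hμ] at hsum
  have hμ0 : 0 ≤ μ := hμ ▸ ENNReal.toReal_nonneg
  have hμT : μ ≤ T := by
    rw [hμ, ← hmean]
    exact ENNReal.toReal_le_of_le_ofReal T.cast_nonneg hle
  have hmoment := expect_iid_sq_sum_le (prodPMF p q) (fun z => g z - μ) _
    (expect_sq_add_sub_mean_le (prodPMF p q) hg0 hgT hμ0 hμT hsum) n 0
  rw [expect_iid_prodPMF] at hmoment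
  have hpoint : ∀ (a : Fin n → A) (b : Fin n → B),
      ‖(tensorVec fun i => f (a i) (b i)) - smoothing K μ (fun i => logOp T q f (a i))
        (tensorVec fun i => f (a i) (b i))‖ₑ ^ 2 ≤
      ENNReal.ofReal ((n * (μ - K))⁻¹ ^ 2) *
        (ENNReal.ofReal ((0 + ∑ i, (g (a i, b i) - μ)) ^ 2) +
          ENNReal.ofReal (n * (T : ℝ) ^ 2)) := by
    intro a b
    have h1 := ENNReal.ofReal_le_ofReal (norm_sub_smoothing_sq_le T q hf h hμ0 hμT hn a b)
    rw [ENNReal.ofReal_pow (norm_nonneg _), ofReal_norm] at h1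
    refine h1.trans_eq ?_
    rw [← ENNReal.ofReal_add (sq_nonneg _) (by positivity), ← ENNReal.ofReal_mul (sq_nonneg _),
      zero_add, mul_comm]
  refine (expect_mono _ fun a => expect_mono _ (hpoint a)).trans ?_
  simp only [expect_const_mul, expect_add, expect_const]
  refine (mul_le_mul_right (add_le_add_left hmoment _) _).trans_eq ?_
  rw [← ENNReal.ofReal_natCast n, ← ENNReal.ofReal_mul n.cast_nonneg,
    ← ENNReal.ofReal_add (by positivity) (by positivity),
    ← ENNReal.ofReal_add (by positivity) (by positivity), ← ENNReal.ofReal_mul (by positivity)]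
  congr 1
  have hn' : (n : ℝ) ≠ 0 := by positivity
  have hd' : μ - K ≠ 0 := by linarith
  field_simp
  ring

end Smoothing

section ExistsSmoothing

variable {A B ι : Type*}

/-- Smoothing operators for the states of words `a`, at any rate `K` below the conditional
entropy: they cut the spectrum at `2^{-nK}` and hardly change the typical output. -/
theorem exists_smoothing (p : PMF A) (q : PMF B) {f : A → B → Hilb ι} (hf : ∀ a b, ‖f a b‖ = 1)
    {R K : ℝ} (hR : ENNReal.ofReal R ≤ condEntropy p fun a => avgState q (f a)) (hK : K < R) :
    ∃ C : ℝ, ∀ n : ℕ, 0 < n → ∃ P : (Fin n → A) → Op (Fin n → ι),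
      (∀ a, IsSelfAdjoint (P a)) ∧ (∀ a v, ‖P a v‖ ≤ ‖v‖) ∧
      (∀ a χ, expect (iid q n) (fun b => ‖⟪tensorVec fun i => f (a i) (b i), P a χ⟫_ℂ‖ₑ ^ 2) ≤
        ENNReal.ofReal (2 ^ (-(n * K))) * ‖χ‖ₑ ^ 2) ∧
      expect (iid p n) (fun a => expect (iid q n) fun b =>
        ‖(tensorVec fun i => f (a i) (b i)) - P a (tensorVec fun i => f (a i) (b i))‖ₑ ^ 2) ≤
        ENNReal.ofReal (C / n) := by
  have hT : ∃ T, K < (expect p fun a => truncEntropy T q (f a)).toReal := by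
    have hfin : ∀ T, expect p (fun a => truncEntropy T q (f a)) ≠ ∞ := fun T =>
      ne_top_of_le_ne_top ENNReal.ofReal_ne_top <| expect_le_const (c := ENNReal.ofReal T) _
        fun a => expect_le_const _ fun b => ENNReal.ofReal_le_ofReal (re_inner_logOp_le T q hf a b)
    rcases lt_or_ge K 0 with h0 | h0
    · exact ⟨0, h0.trans_le ENNReal.toReal_nonneg⟩
    · obtain ⟨T, hT⟩ := exists_lt_truncEntropy p q hf
        (((ENNReal.ofReal_lt_ofReal_iff (h0.trans_lt hK)).2 hK).trans_le hR)
      exact ⟨T, (ENNReal.ofReal_lt_iff_lt_toReal h0 (hfin T)).1 hT⟩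
  obtain ⟨T, hT⟩ := hT
  set μ := (expect p fun a => truncEntropy T q (f a)).toReal with hμ
  refine ⟨2 * T ^ 2 / (μ - K) ^ 2, fun n hn =>
    ⟨fun a => smoothing K μ fun i => logOp T q f (a i), fun a => isSelfAdjoint_fc _ _,
      fun a v => norm_smoothing_apply_le K μ (fun i => isSelfAdjoint_fc _ _) v,
      fun a χ => expect_inner_smoothing_le T q hf hT a χ, ?_⟩⟩
  refine (expect_sub_smoothing_le T p q hf hT hμ hn).trans_eq ?_
  rw [div_div, mul_comm (n : ℝ)]

/-- The unconditional case of `exists_smoothing`. -/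
theorem exists_smoothing_state (q : PMF B) {f : B → Hilb ι} (hf : ∀ b, ‖f b‖ = 1)
    {R K : ℝ} (hR : ENNReal.ofReal R ≤ vnEntropy (avgState q f)) (hK : K < R) :
    ∃ C : ℝ, ∀ n : ℕ, 0 < n → ∃ P : Op (Fin n → ι),
      IsSelfAdjoint P ∧ (∀ v, ‖P v‖ ≤ ‖v‖) ∧
      (∀ χ, expect (iid q n) (fun b => ‖⟪tensorVec fun i => f (b i), P χ⟫_ℂ‖ₑ ^ 2) ≤
        ENNReal.ofReal (2 ^ (-(n * K))) * ‖χ‖ₑ ^ 2) ∧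
      expect (iid q n) (fun b =>
        ‖(tensorVec fun i => f (b i)) - P (tensorVec fun i => f (b i))‖ₑ ^ 2) ≤
        ENNReal.ofReal (C / n) := by
  have hR' : ENNReal.ofReal R ≤ condEntropy (PMF.pure ()) fun _ => avgState q f :=
    hR.trans_eq (expect_pure () fun _ => vnEntropy (avgState q f)).symm
  obtain ⟨C, hC⟩ := exists_smoothing (PMF.pure ()) q (f := fun _ b => f b) (fun _ b => hf b) hR' hK
  refine ⟨C, fun n hn => ?_⟩
  obtain ⟨P, hsa, hnorm, hcut, hclose⟩ := hC n hn
  refine ⟨P fun _ => (), hsa _, hnorm _, hcut _, ?_⟩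
  refine le_of_eq_of_le ?_ hclose
  rw [← expect_const (iid (PMF.pure ()) n) (expect (iid q n) _)]

end ExistsSmoothing

/-! ### A union bound for sequential decoding -/

section Sequential

variable {κ : Type*}

theorem no_apply (v χ : Hilb κ) : (1 - ketBra v : Op κ) χ = χ - ⟪v, χ⟫_ℂ • v := by
  rw [sub_apply, one_apply_eq_self, ketBra, InnerProductSpace.rankOne_apply]

theorem norm_sq_no_apply {v : Hilb κ} (hv : ‖v‖ = 1) (χ : Hilb κ) :
    ‖(1 - ketBra v : Op κ) χ‖ ^ 2 = ‖χ‖ ^ 2 - ‖⟪v, χ⟫_ℂ‖ ^ 2 := by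
  rw [no_apply, norm_sub_sq (𝕜 := ℂ), inner_smul_right, norm_smul, hv,
    inner_mul_symm_re_eq_norm, norm_mul, norm_inner_symm χ v]
  ring

theorem norm_afterNo_le : ∀ (vs : List (Hilb κ)), (∀ v ∈ vs, ‖v‖ = 1) → ∀ χ : Hilb κ,
    ‖afterNo vs χ‖ ≤ ‖χ‖
  | [], _, _ => le_rfl
  | v :: vs, hvs, χ => by
    refine (norm_afterNo_le vs (fun w hw => hvs w (List.mem_cons_of_mem _ hw)) _).trans ?_
    refine le_of_sq_le_sq ?_ (norm_nonneg _)
    rw [norm_sq_no_apply (hvs v List.mem_cons_self)]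
    linarith [sq_nonneg ‖⟪v, χ⟫_ℂ‖]

/-- The overlap with an auxiliary vector `ψ` that is lost in a sequence of tests. The probability
of a "yes" somewhere in the sequence is the telescoping sum `‖χ‖² - ‖afterNo vs χ‖²`, so that
the Cauchy–Schwarz inequality needs only the overlaps of `ψ` with the tests. -/
theorem norm_inner_sub_inner_afterNo_le (ψ : Hilb κ) {θ : ℝ} (hθ : 0 < θ) :
    ∀ (vs : List (Hilb κ)), (∀ v ∈ vs, ‖v‖ = 1) → ∀ χ : Hilb κ,
    2 * ‖⟪ψ, χ⟫_ℂ - ⟪ψ, afterNo vs χ⟫_ℂ‖ ≤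
      θ * (‖χ‖ ^ 2 - ‖afterNo vs χ‖ ^ 2) + (vs.map fun v => ‖⟪v, ψ⟫_ℂ‖ ^ 2).sum / θ
  | [], _, χ => by simp [afterNo]
  | v :: vs, hvs, χ => by
    set χ' := (1 - ketBra v : Op κ) χ with hχ'
    have ih := norm_inner_sub_inner_afterNo_le ψ hθ vs
      (fun w hw => hvs w (List.mem_cons_of_mem _ hw)) χ'
    have h1 : ‖χ'‖ ^ 2 = ‖χ‖ ^ 2 - ‖⟪v, χ⟫_ℂ‖ ^ 2 :=
      norm_sq_no_apply (hvs v List.mem_cons_self) χ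
    have h2 : ‖⟪ψ, χ⟫_ℂ - ⟪ψ, χ'⟫_ℂ‖ = ‖⟪v, χ⟫_ℂ‖ * ‖⟪v, ψ⟫_ℂ‖ := by
      rw [← inner_sub_right, hχ', no_apply, sub_sub_cancel, inner_smul_right, norm_mul,
        norm_inner_symm ψ v]
    have h3 : 2 * (‖⟪v, χ⟫_ℂ‖ * ‖⟪v, ψ⟫_ℂ‖) ≤ θ * ‖⟪v, χ⟫_ℂ‖ ^ 2 + ‖⟪v, ψ⟫_ℂ‖ ^ 2 / θ := by
      have h4 := div_nonneg (sq_nonneg (θ * ‖⟪v, χ⟫_ℂ‖ - ‖⟪v, ψ⟫_ℂ‖)) hθ.le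
      have h5 : (θ * ‖⟪v, χ⟫_ℂ‖ - ‖⟪v, ψ⟫_ℂ‖) ^ 2 / θ =
          θ * ‖⟪v, χ⟫_ℂ‖ ^ 2 - 2 * (‖⟪v, χ⟫_ℂ‖ * ‖⟪v, ψ⟫_ℂ‖) + ‖⟪v, ψ⟫_ℂ‖ ^ 2 / θ := by
        field_simp
        ring
      linarith
    have h4 : afterNo (v :: vs) χ = afterNo vs χ' := rfl
    rw [h4, List.map_cons, List.sum_cons, add_div]
    have h5 := norm_sub_le_norm_sub_add_norm_sub ⟪ψ, χ⟫_ℂ ⟪ψ, χ'⟫_ℂ ⟪ψ, afterNo vs χ'⟫_ℂ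
    rw [h2] at h5
    rw [h1] at ih
    linarith

/-- The error of sequential decoding is controlled by any vector `ψ` that is close to the
transmitted one and nearly orthogonal to the vectors tested before it. -/
theorem one_sub_le_of_afterNo (vs : List (Hilb κ)) (hvs : ∀ v ∈ vs, ‖v‖ = 1) {φ : Hilb κ}
    (hφ : ‖φ‖ = 1) (ψ : Hilb κ) {θ : ℝ} (hθ : 0 < θ) :
    1 - ‖ketBra φ (afterNo vs φ)‖ ^ 2 ≤
      3 * θ + 2 * (‖φ - ψ‖ ^ 2 + (vs.map fun v => ‖⟪v, ψ⟫_ℂ‖ ^ 2).sum) / θ := by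
  set χ := afterNo vs φ with hχ
  set S := (vs.map fun v => ‖⟪v, ψ⟫_ℂ‖ ^ 2).sum with hS
  set η := ‖φ - ψ‖ with hη
  have hS0 : 0 ≤ S := List.sum_nonneg (by
    intro x hx
    obtain ⟨v, -, rfl⟩ := List.mem_map.1 hx
    positivity)
  have h1 := norm_inner_sub_inner_afterNo_le ψ hθ vs hvs φ
  rw [← hχ, ← hS, hφ] at h1
  have hχ1 : ‖χ‖ ≤ 1 := (norm_afterNo_le vs hvs φ).trans_eq hφ
  have h2 : ‖ketBra φ χ‖ = ‖⟪φ, χ⟫_ℂ‖ := by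
    rw [ketBra, InnerProductSpace.rankOne_apply, norm_smul, hφ, mul_one]
  have h3 : ‖⟪φ, φ⟫_ℂ‖ = 1 := by simp [inner_self_eq_norm_sq_to_K, hφ]
  have hclose : ∀ w : Hilb κ, ‖w‖ ≤ 1 → ‖⟪φ, w⟫_ℂ - ⟪ψ, w⟫_ℂ‖ ≤ η := fun w hw => by
    rw [← inner_sub_left]
    refine (norm_inner_le_norm _ _).trans ?_
    exact mul_le_of_le_one_right (norm_nonneg _) hw
  have h4 := hclose φ hφ.le
  have h5 := hclose χ hχ1
  -- The overlap `⟪φ, χ⟫` is compared with `⟪ψ, χ⟫`, then with `⟪ψ, φ⟫` and `⟪φ, φ⟫ = 1`.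
  have h6 : ‖⟪φ, φ⟫_ℂ‖ ≤ ‖⟪φ, φ⟫_ℂ - ⟪ψ, φ⟫_ℂ‖ + ‖⟪ψ, φ⟫_ℂ - ⟪ψ, χ⟫_ℂ‖ +
      ‖⟪φ, χ⟫_ℂ - ⟪ψ, χ⟫_ℂ‖ + ‖⟪φ, χ⟫_ℂ‖ := by
    have e : ⟪φ, φ⟫_ℂ = (⟪φ, φ⟫_ℂ - ⟪ψ, φ⟫_ℂ) + (⟪ψ, φ⟫_ℂ - ⟪ψ, χ⟫_ℂ) -
      (⟪φ, χ⟫_ℂ - ⟪ψ, χ⟫_ℂ) + ⟪φ, χ⟫_ℂ := by ring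
    refine (congrArg norm e).trans_le ?_
    refine (norm_add_le _ _).trans (add_le_add_left ?_ _)
    exact (norm_sub_le _ _).trans (add_le_add_left (norm_add_le _ _) _)
  have h7 : 2 * η ≤ θ + η ^ 2 / θ := by
    have h8 := div_nonneg (sq_nonneg (θ - η)) hθ.le
    have h9 : (θ - η) ^ 2 / θ = θ - 2 * η + η ^ 2 / θ := by
      field_simp
      ring
    linarith
  have h8 : 2 * (η ^ 2 + S) / θ = 2 * (η ^ 2 / θ) + 2 * (S / θ) := by ring
  have h9 : 0 ≤ S / θ := div_nonneg hS0 hθ.le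
  have h10 : θ * (1 ^ 2 - ‖χ‖ ^ 2) ≤ θ := by nlinarith [sq_nonneg ‖χ‖]
  rw [h2, h8]
  nlinarith [sq_nonneg (1 - ‖⟪φ, χ⟫_ℂ‖)]

end Sequential

section GoodCode

variable {X Y ι : Type*} {n L M : ℕ}

theorem norm_outputVec (W : PureMAC X Y ι) (C : Code X Y n L M) (k : Fin L × Fin M) :
    ‖outputVec W C k‖ = 1 :=
  norm_tensorVec _ fun _ => W.norm_φ _ _

theorem nodup_scanOrder (L M : ℕ) : (scanOrder L M).Nodup := by
  rw [scanOrder, List.nodup_flatMap]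
  refine ⟨fun m _ => (List.nodup_finRange L).map fun a b h => (Prod.ext_iff.1 h).1, ?_⟩
  refine (List.nodup_finRange M).pairwise_of_forall_ne ?_
  intro m _ m' _ hne
  simp only [Function.onFun, List.disjoint_left, List.mem_map]
  rintro _ ⟨l, -, rfl⟩ ⟨l', -, h⟩
  exact hne (Prod.ext_iff.1 h).2.symm

/-- The code admits vectors `ψ k` near the outputs `φ k` that are nearly orthogonal to all the
other outputs, on average over `k` with total defect at most `ε`. This implies a small error
of every sequential decoder, and it is stable under concatenation of codes. -/
def GoodCode (W : PureMAC X Y ι) (C : Code X Y n L M) (ε : ℝ) : Prop :=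
  ∃ ψ : Fin L × Fin M → Hilb (Fin n → ι), (∀ k, ‖ψ k‖ ≤ 1) ∧
    ∑ k, (‖outputVec W C k - ψ k‖ ^ 2 +
      ∑ j ∈ Finset.univ.erase k, ‖⟪outputVec W C j, ψ k⟫_ℂ‖ ^ 2) ≤ L * M * ε

theorem avgError_le_of_goodCode (W : PureMAC X Y ι) (C : Code X Y n L M) {ε : ℝ}
    (hL : 0 < L) (hM : 0 < M) (h : GoodCode W C ε) {θ : ℝ} (hθ : 0 < θ) :
    avgError W C ≤ 3 * θ + 2 * ε / θ := by
  obtain ⟨ψ, -, hψ⟩ := h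
  have hLM : (0 : ℝ) < L * M := by positivity
  have hk : ∀ k, 1 - declareProb W C (outputVec W C k) k ≤
      3 * θ + 2 / θ * (‖outputVec W C k - ψ k‖ ^ 2 +
        ∑ j ∈ Finset.univ.erase k, ‖⟪outputVec W C j, ψ k⟫_ℂ‖ ^ 2) := by
    intro k
    set l := (scanOrder L M).takeWhile (fun j => j ≠ k) with hl
    have h1 := one_sub_le_of_afterNo (l.map (outputVec W C)) (by
      intro v hv
      obtain ⟨j, -, rfl⟩ := List.mem_map.1 hv
      exact norm_outputVec W C j) (norm_outputVec W C k) (ψ k) hθ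
    refine h1.trans (le_of_le_of_eq ?_ (by ring :
      3 * θ + 2 * (‖outputVec W C k - ψ k‖ ^ 2 +
        ∑ j ∈ Finset.univ.erase k, ‖⟪outputVec W C j, ψ k⟫_ℂ‖ ^ 2) / θ = _))
    have hnd : l.Nodup := (nodup_scanOrder L M).sublist (List.takeWhile_sublist _)
    gcongr
    rw [List.map_map, ← List.sum_toFinset _ hnd]
    refine Finset.sum_le_sum_of_subset_of_nonneg (fun j hj => ?_) fun _ _ _ => sq_nonneg _
    have h2 := List.mem_takeWhile_imp (List.mem_toFinset.1 hj)
    simpa using h2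
  have h3 : avgError W C =
      (∑ k, (1 - declareProb W C (outputVec W C k) k)) / (L * M) := by
    rw [avgError, Finset.sum_sub_distrib]
    simp
    field_simp
  rw [h3, div_le_iff₀ hLM]
  refine (Finset.sum_le_sum fun k _ => hk k).trans ?_
  rw [Finset.sum_add_distrib, ← Finset.mul_sum _ _ (2 / θ)]
  have h4 := mul_le_mul_of_nonneg_left hψ (div_nonneg zero_le_two hθ.le)
  refine (add_le_add_right h4 _).trans_eq ?_
  simp
  ring

/-- Achievability in the sense of good codes. -/
def GoodAchievable (W : PureMAC X Y ι) (r : ℝ × ℝ) : Prop :=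
  ∀ ε > (0 : ℝ), ∀ δ > (0 : ℝ), ∃ N : ℕ, ∀ n ≥ N, ∃ (L M : ℕ) (C : Code X Y n L M),
    (2 : ℝ) ^ ((n : ℝ) * (r.1 - δ)) ≤ L ∧ (2 : ℝ) ^ ((n : ℝ) * (r.2 - δ)) ≤ M ∧ GoodCode W C ε

theorem GoodAchievable.seqAchievable {W : PureMAC X Y ι} {r : ℝ × ℝ} (h : GoodAchievable W r) :
    SeqAchievable W r := by
  intro ε hε δ hδ
  -- The bound `3 θ + 2 ε' / θ` on the error is `ε` for `ε' = ε² / 24` and `θ = ε / 6`.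
  obtain ⟨N, hN⟩ := h (ε ^ 2 / 24) (by positivity) δ hδ
  refine ⟨N, fun n hn => ?_⟩
  obtain ⟨L, M, C, hL, hM, hC⟩ := hN n hn
  refine ⟨L, M, C, hL, hM, ?_⟩
  -- The codes are nonempty, so that `avgError` is not a junk value.
  have hL' : 0 < L := by
    have : (0 : ℝ) < L := lt_of_lt_of_le (by positivity) hL
    exact_mod_cast this
  have hM' : 0 < M := by
    have : (0 : ℝ) < M := lt_of_lt_of_le (by positivity) hM
    exact_mod_cast this
  refine (avgError_le_of_goodCode W C hL' hM' hC (θ := ε / 6) (by positivity)).trans_eq ?_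
  field_simp
  ring

end GoodCode

/-! ### Random coding -/

section RandomCoding

theorem expect_iid_apply {A : Type*} (p : PMF A) {n : ℕ} (i : Fin n) (f : A → ℝ≥0∞) :
    expect (iid p n) (fun z => f (z i)) = expect p f := by
  rw [expect_iid_resample p n i]
  simp [expect_const]

theorem enorm_sq_eq_ofReal {E : Type*} [SeminormedAddGroup E] (v : E) :
    ‖v‖ₑ ^ 2 = ENNReal.ofReal (‖v‖ ^ 2) := by
  rw [ENNReal.ofReal_pow (norm_nonneg _), ofReal_norm]

theorem enorm_add_sq_le {E : Type*} [SeminormedAddGroup E] (v w : E) :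
    ‖v + w‖ₑ ^ 2 ≤ 2 * (‖v‖ₑ ^ 2 + ‖w‖ₑ ^ 2) := by
  rw [enorm_sq_eq_ofReal, enorm_sq_eq_ofReal, enorm_sq_eq_ofReal,
    ← ENNReal.ofReal_add (sq_nonneg _) (sq_nonneg _), ← ENNReal.ofReal_ofNat 2,
    ← ENNReal.ofReal_mul zero_le_two]
  refine ENNReal.ofReal_le_ofReal ?_
  have := pow_le_pow_left₀ (norm_nonneg _) (norm_add_le v w) 2
  nlinarith [sq_nonneg (‖v‖ - ‖w‖)]

/-- Among the message pairs `j ≠ k`, `L - 1` have the same second message as `k`, `M - 1` have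
the same first message, and `(L - 1) (M - 1)` share none. -/
theorem sum_erase_le {L M : ℕ} (k : Fin L × Fin M) (F : Fin L × Fin M → ℝ≥0∞) {b₁ b₂ b₃ : ℝ≥0∞}
    (h₁ : ∀ l, l ≠ k.1 → F (l, k.2) ≤ b₁) (h₂ : ∀ m, m ≠ k.2 → F (k.1, m) ≤ b₂)
    (h₃ : ∀ l m, l ≠ k.1 → m ≠ k.2 → F (l, m) ≤ b₃) :
    ∑ j ∈ Finset.univ.erase k, F j ≤
      ((L - 1 : ℕ) * b₁ + (M - 1 : ℕ) * b₂ + (L - 1 : ℕ) * (M - 1 : ℕ) * b₃ : ℝ≥0∞) := by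
  have hsub : Finset.univ.erase k ⊆ (Finset.univ.erase k.1 ×ˢ {k.2} ∪
      {k.1} ×ˢ Finset.univ.erase k.2) ∪ Finset.univ.erase k.1 ×ˢ Finset.univ.erase k.2 := by
    rintro ⟨l, m⟩ h
    have h' : ¬ (l = k.1 ∧ m = k.2) := by simpa [Prod.ext_iff] using h
    simp only [Finset.mem_union, Finset.mem_product, Finset.mem_erase, Finset.mem_univ,
      Finset.mem_singleton, and_true]
    tauto
  have hunion : ∀ s t : Finset (Fin L × Fin M), ∑ j ∈ s ∪ t, F j ≤ ∑ j ∈ s, F j + ∑ j ∈ t, F j :=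
    fun s t => by
      rw [← Finset.sum_union_inter]
      exact le_self_add
  refine (Finset.sum_le_sum_of_subset hsub).trans ((hunion _ _).trans
    (add_le_add ((hunion _ _).trans (add_le_add ?_ ?_)) ?_))
  · refine (Finset.sum_le_card_nsmul _ _ b₁ ?_).trans_eq ?_
    · rintro ⟨l, m⟩ h
      simp only [Finset.mem_product, Finset.mem_erase, Finset.mem_singleton] at h
      rw [h.2]
      exact h₁ l h.1.1
    · simp [Finset.card_erase_of_mem]
  · refine (Finset.sum_le_card_nsmul _ _ b₂ ?_).trans_eq ?_
    · rintro ⟨l, m⟩ h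
      simp only [Finset.mem_product, Finset.mem_erase, Finset.mem_singleton] at h
      rw [h.1]
      exact h₂ m h.2.1
    · simp [Finset.card_erase_of_mem]
  · refine (Finset.sum_le_card_nsmul _ _ b₃ ?_).trans_eq ?_
    · rintro ⟨l, m⟩ h
      simp only [Finset.mem_product, Finset.mem_erase] at h
      exact h₃ l m h.1.1 h.2.1
    · simp [Finset.card_erase_of_mem]

variable {X Y ι : Type*}

/-- The output for the input words `x` and `y`. -/
def wordVec (W : PureMAC X Y ι) {n : ℕ} (x : Fin n → X) (y : Fin n → Y) : Hilb (Fin n → ι) :=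
  tensorVec fun i => W.φ (x i) (y i)

theorem norm_wordVec (W : PureMAC X Y ι) {n : ℕ} (x : Fin n → X) (y : Fin n → Y) :
    ‖wordVec W x y‖ = 1 :=
  norm_tensorVec _ fun _ => W.norm_φ _ _

theorem enorm_le_one {E : Type*} [SeminormedAddGroup E] {v : E} (h : ‖v‖ ≤ 1) : ‖v‖ₑ ≤ 1 := by
  rw [← ofReal_norm]
  exact ENNReal.ofReal_le_one.2 h

theorem mul_enorm_sq_le {E : Type*} [SeminormedAddGroup E] {v : E} (h : ‖v‖ ≤ 1) (b : ℝ≥0∞) :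
    b * ‖v‖ₑ ^ 2 ≤ b :=
  mul_le_of_le_one_right' (pow_le_one' (enorm_le_one h) 2)

/-- Random coding. The auxiliary vector of a message pair is its output, smoothed first for the
ensemble given the second sender's word and then for the full ensemble. In this order, the
overlap with an output that shares only the second sender's word is small because of `P₁`, and
the overlap with an output that shares none is small because of `P₀`. An output that shares the
first sender's word is nearly orthogonal to any fixed vector. -/
theorem exists_goodCode (W : PureMAC X Y ι) (pX : PMF X) (pY : PMF Y) (n L M : ℕ)
    {P₀ : Op (Fin n → ι)} (hs₀ : IsSelfAdjoint P₀) (hn₀ : ∀ v, ‖P₀ v‖ ≤ ‖v‖)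
    {P₁ : (Fin n → Y) → Op (Fin n → ι)} (hs₁ : ∀ y, IsSelfAdjoint (P₁ y))
    (hn₁ : ∀ y v, ‖P₁ y v‖ ≤ ‖v‖) {b₁ b₂ b₃ c₀ c₁ : ℝ≥0∞}
    (h₁ : ∀ y χ, expect (iid pX n) (fun x => ‖⟪wordVec W x y, P₁ y χ⟫_ℂ‖ₑ ^ 2) ≤ b₁ * ‖χ‖ₑ ^ 2)
    (h₂ : ∀ x χ, expect (iid pY n) (fun y => ‖⟪wordVec W x y, χ⟫_ℂ‖ₑ ^ 2) ≤ b₂ * ‖χ‖ₑ ^ 2)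
    (h₃ : ∀ χ, expect (iid pX n) (fun x => expect (iid pY n) fun y =>
      ‖⟪wordVec W x y, P₀ χ⟫_ℂ‖ₑ ^ 2) ≤ b₃ * ‖χ‖ₑ ^ 2)
    (h₄ : expect (iid pX n) (fun x => expect (iid pY n) fun y =>
      ‖wordVec W x y - P₀ (wordVec W x y)‖ₑ ^ 2) ≤ c₀)
    (h₅ : expect (iid pY n) (fun y => expect (iid pX n) fun x =>
      ‖wordVec W x y - P₁ y (wordVec W x y)‖ₑ ^ 2) ≤ c₁) {ε : ℝ} (hε0 : 0 ≤ ε)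
    (hε : 2 * (c₀ + c₁) + ((L - 1 : ℕ) * b₁ + (M - 1 : ℕ) * b₂ +
      (L - 1 : ℕ) * (M - 1 : ℕ) * b₃) ≤ ENNReal.ofReal ε) :
    ∃ C : Code X Y n L M, GoodCode W C ε := by
  set ψ : (Fin n → X) → (Fin n → Y) → Hilb (Fin n → ι) := fun x y =>
    P₀ (P₁ y (wordVec W x y)) with hψ
  have hψ1 : ∀ x y, ‖ψ x y‖ ≤ 1 := fun x y =>
    ((hn₀ _).trans (hn₁ _ _)).trans_eq (norm_wordVec W x y)
  set pXn := iid pX n with hpXn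
  set pYn := iid pY n with hpYn
  -- The defect of the pair `k`, as a function of the two codebooks.
  set Q : Fin L × Fin M → (Fin L → Fin n → X) → (Fin M → Fin n → Y) → ℝ≥0∞ := fun k cx cy =>
    ‖wordVec W (cx k.1) (cy k.2) - ψ (cx k.1) (cy k.2)‖ₑ ^ 2 +
      ∑ j ∈ Finset.univ.erase k, ‖⟪wordVec W (cx j.1) (cy j.2), ψ (cx k.1) (cy k.2)⟫_ℂ‖ₑ ^ 2 with hQ
  have hclose : ∀ x y, ‖wordVec W x y - ψ x y‖ₑ ^ 2 ≤
      2 * (‖wordVec W x y - P₀ (wordVec W x y)‖ₑ ^ 2 +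
        ‖wordVec W x y - P₁ y (wordVec W x y)‖ₑ ^ 2) := by
    intro x y
    have e : wordVec W x y - ψ x y = (wordVec W x y - P₀ (wordVec W x y)) +
        P₀ (wordVec W x y - P₁ y (wordVec W x y)) := by
      rw [map_sub]
      abel
    rw [e]
    refine (enorm_add_sq_le _ _).trans ?_
    gcongr 2 * (_ + ?_ ^ 2)
    rw [← ofReal_norm, ← ofReal_norm]
    exact ENNReal.ofReal_le_ofReal (hn₀ _)
  have hQclose : ∀ k : Fin L × Fin M, expect (iid pXn L) (fun cx => expect (iid pYn M) fun cy =>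
      ‖wordVec W (cx k.1) (cy k.2) - ψ (cx k.1) (cy k.2)‖ₑ ^ 2) ≤ 2 * (c₀ + c₁) := by
    intro k
    have e1 : ∀ F : (Fin n → X) → (Fin n → Y) → ℝ≥0∞,
        expect (iid pXn L) (fun cx => expect (iid pYn M) fun cy => F (cx k.1) (cy k.2)) =
          expect pXn fun x => expect pYn fun y => F x y := fun F => by
      rw [← expect_iid_apply pXn k.1]
      congr 1
      ext cx
      exact expect_iid_apply pYn k.2 (F (cx k.1))
    rw [e1 fun x y => ‖wordVec W x y - ψ x y‖ₑ ^ 2]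
    refine (expect_mono _ fun x => expect_mono _ (hclose x)).trans ?_
    simp only [expect_const_mul, expect_add]
    gcongr
    rw [expect_comm]
    exact h₅
  have hQ₁ : ∀ (k : Fin L × Fin M) (l : Fin L), l ≠ k.1 →
      expect (iid pXn L) (fun cx => expect (iid pYn M) fun cy =>
        ‖⟪wordVec W (cx l) (cy k.2), ψ (cx k.1) (cy k.2)⟫_ℂ‖ₑ ^ 2) ≤ b₁ := by
    intro k l hl
    rw [expect_comm]
    refine expect_le_const _ fun cy => expect_iid_le_of_resample pXn k.1 fun cx => ?_
    simp only [Function.update_self, Function.update_of_ne hl]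
    have e : ∀ x, ‖⟪wordVec W (cx l) (cy k.2), ψ x (cy k.2)⟫_ℂ‖ₑ =
        ‖⟪wordVec W x (cy k.2), P₁ (cy k.2) (P₀ (wordVec W (cx l) (cy k.2)))⟫_ℂ‖ₑ := fun x => by
      rw [hψ, ← inner_selfAdjoint hs₀, ← inner_selfAdjoint (hs₁ _), ← ofReal_norm,
        norm_inner_symm, ofReal_norm]
    simp only [e]
    exact (h₁ _ _).trans (mul_enorm_sq_le ((hn₀ _).trans_eq (norm_wordVec W _ _)) _)
  have hQ₂ : ∀ (k : Fin L × Fin M) (m : Fin M), m ≠ k.2 →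
      expect (iid pXn L) (fun cx => expect (iid pYn M) fun cy =>
        ‖⟪wordVec W (cx k.1) (cy m), ψ (cx k.1) (cy k.2)⟫_ℂ‖ₑ ^ 2) ≤ b₂ := by
    intro k m hm
    refine expect_le_const _ fun cx => expect_iid_le_of_resample pYn m fun cy => ?_
    simp only [Function.update_self, Function.update_of_ne hm.symm]
    exact (h₂ _ _).trans (mul_enorm_sq_le (hψ1 _ _) _)
  have hQ₃ : ∀ (k : Fin L × Fin M) (l : Fin L) (m : Fin M), l ≠ k.1 → m ≠ k.2 →
      expect (iid pXn L) (fun cx => expect (iid pYn M) fun cy =>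
        ‖⟪wordVec W (cx l) (cy m), ψ (cx k.1) (cy k.2)⟫_ℂ‖ₑ ^ 2) ≤ b₃ := by
    intro k l m hl hm
    refine expect_iid_le_of_resample pXn l fun cx => ?_
    rw [expect_comm]
    refine expect_iid_le_of_resample pYn m fun cy => ?_
    rw [expect_comm]
    simp only [Function.update_self, Function.update_of_ne hl.symm, Function.update_of_ne hm.symm]
    exact (h₃ _).trans (mul_enorm_sq_le ((hn₁ _ _).trans_eq (norm_wordVec W _ _)) _)
  have hk : ∀ k, expect (iid pXn L) (fun cx => expect (iid pYn M) fun cy => Q k cx cy) ≤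
      ENNReal.ofReal ε := by
    intro k
    simp only [hQ, expect_add, expect_finset_sum]
    refine le_trans (add_le_add (hQclose k) ?_) hε
    exact sum_erase_le k _ (hQ₁ k) (hQ₂ k) (hQ₃ k)
  have htot : expect (iid pXn L) (fun cx => expect (iid pYn M) fun cy => ∑ k, Q k cx cy) ≤
      ENNReal.ofReal (L * M * ε) := by
    simp only [expect_finset_sum]
    refine (Finset.sum_le_sum fun k _ => hk k).trans_eq ?_
    rw [Finset.sum_const, nsmul_eq_mul, ENNReal.ofReal_mul (by positivity)]
    simp [ENNReal.ofReal_mul]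
  obtain ⟨cx, hcx⟩ := exists_le_of_expect_le _ ENNReal.ofReal_ne_top htot
  obtain ⟨cy, hcy⟩ := exists_le_of_expect_le _ ENNReal.ofReal_ne_top hcx
  refine ⟨⟨cx, cy⟩, fun k => ψ (cx k.1) (cy k.2), fun k => hψ1 _ _, ?_⟩
  rw [← ENNReal.ofReal_le_ofReal_iff (by positivity)]
  refine le_of_eq_of_le ?_ hcy
  rw [ENNReal.ofReal_sum_of_nonneg fun _ _ => by positivity]
  refine Finset.sum_congr rfl fun k _ => ?_
  rw [ENNReal.ofReal_add (by positivity) (by positivity),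
    ENNReal.ofReal_sum_of_nonneg fun _ _ => by positivity]
  simp only [hQ, enorm_sq_eq_ofReal]
  rfl

end RandomCoding

/-! ### Achievability of the two pentagons -/

section Pentagons

variable {X Y ι : Type*}

theorem natCast_ceil_sub_one_le {t : ℝ} (ht : 0 ≤ t) :
    ((⌈t⌉₊ - 1 : ℕ) : ℝ≥0∞) ≤ ENNReal.ofReal t := by
  rw [← ENNReal.ofReal_natCast]
  refine ENNReal.ofReal_le_ofReal ?_
  rcases Nat.eq_zero_or_pos ⌈t⌉₊ with h | h
  · simpa [h] using ht
  · rw [Nat.cast_pred h]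
    linarith [Nat.ceil_lt_add_one ht]

theorem tendsto_div_add_two_rpow (C : ℝ) {δ : ℝ} (hδ : 0 < δ) :
    Filter.Tendsto (fun n : ℕ => C / n + 3 * (2 : ℝ) ^ (-(n * δ))) Filter.atTop (nhds 0) := by
  have h1 : Filter.Tendsto (fun n : ℕ => C / (n : ℝ)) Filter.atTop (nhds 0) :=
    tendsto_const_div_atTop_nhds_zero_nat C
  have h2 : Filter.Tendsto (fun n : ℕ => ((2 : ℝ) ^ (-δ)) ^ n) Filter.atTop (nhds 0) :=
    tendsto_pow_atTop_nhds_zero_of_lt_one (by positivity)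
      (Real.rpow_lt_one_of_one_lt_of_neg one_lt_two (by linarith))
  have h3 : ∀ n : ℕ, ((2 : ℝ) ^ (-δ)) ^ n = (2 : ℝ) ^ (-(n * δ)) := fun n => by
    rw [← Real.rpow_natCast, ← Real.rpow_mul zero_le_two]
    congr 1
    ring
  simp only [h3] at h2
  simpa using h1.add (h2.const_mul 3)

theorem ofReal_two_rpow_mul_le {u v w : ℝ} (h : u + v ≤ w) :
    ENNReal.ofReal (2 ^ u) * ENNReal.ofReal (2 ^ v) ≤ ENNReal.ofReal (2 ^ w) := by
  rw [← ENNReal.ofReal_mul (by positivity), ← Real.rpow_add two_pos]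
  exact ENNReal.ofReal_le_ofReal (Real.rpow_le_rpow_of_exponent_le one_le_two h)

theorem goodAchievable_of_mem_region₂ (W : PureMAC X Y ι) (pX : PMF X) (pY : PMF Y) {r : ℝ × ℝ}
    (hr : r ∈ region₂ W pX pY) : GoodAchievable W r := by
  obtain ⟨h1, h2, hBY, hmin, hB⟩ := hr
  intro ε hε δ hδ
  have hδ2 : 0 < δ / 2 := by linarith
  obtain ⟨C₁, hC₁⟩ := exists_smoothing pY pX (f := fun y x => W.φ x y) (fun y x => W.norm_φ x y)
    (R := r.1) (K := r.1 - δ / 2) hBY (by linarith)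
  have hB' : ENNReal.ofReal (r.1 + r.2) ≤
      vnEntropy (avgState (prodPMF pX pY) fun z => W.φ z.1 z.2) := by
    rw [← stateB_eq]
    exact hB
  obtain ⟨C₀, hC₀⟩ := exists_smoothing_state (prodPMF pX pY) (f := fun z => W.φ z.1 z.2)
    (fun z => W.norm_φ z.1 z.2) (K := r.1 + r.2 - δ) hB' (by linarith)
  -- The smoothing rates lie above the code rates `r.1 - δ` and `r.1 + r.2 - 2 δ`, which leaves
  -- exponentially small overlaps.
  have hlim := tendsto_div_add_two_rpow (2 * (|C₀| + |C₁|)) hδ2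
  obtain ⟨N, hN⟩ := Filter.eventually_atTop.1 ((tendsto_order.1 hlim).2 ε hε)
  refine ⟨max N 1, fun n hn => ?_⟩
  have hn0 : 0 < n := lt_of_lt_of_le one_pos ((le_max_right _ _).trans hn)
  obtain ⟨P₁, hs₁, hn₁, hcut₁, hclose₁⟩ := hC₁ n hn0
  obtain ⟨P₀, hs₀, hn₀, hcut₀, hclose₀⟩ := hC₀ n hn0
  simp only [expect_iid_prodPMF] at hcut₀ hclose₀
  have hm : r.2 ≤ minEntBX W pY :=
    (ENNReal.ofReal_le_ofReal_iff (condMinEntropy_nonneg pY fun x y => W.norm_φ x y)).1 hmin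
  have hcut₂ : ∀ (x : Fin n → X) χ, expect (iid pY n) (fun y => ‖⟪wordVec W x y, χ⟫_ℂ‖ₑ ^ 2) ≤
      ENNReal.ofReal (2 ^ (-r.2)) ^ n * ‖χ‖ₑ ^ 2 :=
    expect_inner_tensorVec_le pY W.φ _ fun x χ =>
      expect_inner_le_of_le_minEntropy pY (W.norm_φ x)
        (hm.trans (condMinEntropy_le pY W.norm_φ x)) χ
  have hb₂ : ENNReal.ofReal (2 ^ (-r.2)) ^ n = ENNReal.ofReal (2 ^ (-(n * r.2))) := by
    rw [← ENNReal.ofReal_pow (by positivity), ← Real.rpow_natCast, ← Real.rpow_mul zero_le_two]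
    congr 2
    ring
  rw [hb₂] at hcut₂
  set t₁ : ℝ := 2 ^ ((n : ℝ) * (r.1 - δ)) with ht₁
  set t₂ : ℝ := 2 ^ ((n : ℝ) * (r.2 - δ)) with ht₂
  have hL := natCast_ceil_sub_one_le (t := t₁) (by positivity)
  have hM := natCast_ceil_sub_one_le (t := t₂) (by positivity)
  obtain ⟨C, hC⟩ := exists_goodCode W pX pY n ⌈t₁⌉₊ ⌈t₂⌉₊ hs₀ hn₀ hs₁ hn₁ hcut₁ hcut₂ hcut₀
    hclose₀ hclose₁ hε.le <| by
    have hnn : (0 : ℝ) < n := by exact_mod_cast hn0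
    calc _ ≤ 2 * (ENNReal.ofReal (|C₀| / n) + ENNReal.ofReal (|C₁| / n)) +
          (ENNReal.ofReal (2 ^ (-(n * (δ / 2)))) + ENNReal.ofReal (2 ^ (-(n * (δ / 2)))) +
            ENNReal.ofReal (2 ^ (-(n * (δ / 2))))) := by
          refine add_le_add (mul_le_mul_right (add_le_add ?_ ?_) _)
            (add_le_add (add_le_add ?_ ?_) ?_)
          · exact ENNReal.ofReal_le_ofReal (by gcongr; exact le_abs_self _)
          · exact ENNReal.ofReal_le_ofReal (by gcongr; exact le_abs_self _)
          · refine (mul_le_mul_left hL _).trans (ofReal_two_rpow_mul_le (le_of_eq ?_))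
            ring
          · refine (mul_le_mul_left hM _).trans (ofReal_two_rpow_mul_le ?_)
            nlinarith
          · have hLM := (mul_le_mul' hL hM).trans
              (ofReal_two_rpow_mul_le (le_refl (n * (r.1 - δ) + n * (r.2 - δ))))
            refine (mul_le_mul_left hLM _).trans (ofReal_two_rpow_mul_le ?_)
            nlinarith
      _ = ENNReal.ofReal (2 * (|C₀| + |C₁|) / n + 3 * (2 : ℝ) ^ (-(n * (δ / 2)))) := by
          rw [← ENNReal.ofReal_add (by positivity) (by positivity),
            ← ENNReal.ofReal_add (by positivity) (by positivity),
            ← ENNReal.ofReal_add (by positivity) (by positivity), ← ENNReal.ofReal_ofNat 2,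
            ← ENNReal.ofReal_mul zero_le_two, ← ENNReal.ofReal_add (by positivity) (by positivity)]
          congr 1
          ring
      _ ≤ ENNReal.ofReal ε := ENNReal.ofReal_le_ofReal (hN n ((le_max_left _ _).trans hn)).le
  exact ⟨_, _, C, Nat.le_ceil _, Nat.le_ceil _, hC⟩

/-- The channel with the roles of the senders exchanged. -/
def PureMAC.swap (W : PureMAC X Y ι) : PureMAC Y X ι :=
  ⟨fun y x => W.φ x y, fun y x => W.norm_φ x y⟩

theorem entB_swap (W : PureMAC X Y ι) (pX : PMF X) (pY : PMF Y) :
    entB W.swap pY pX = entB W pX pY := by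
  have h : stateB W.swap pY pX = stateB W pX pY := by
    rw [stateB, stateB, ← (Equiv.prodComm X Y).tsum_eq]
    simp [PureMAC.swap, mul_comm]
  rw [entB, h, entB]

/-- Good codes may be read with the roles of the senders exchanged, since the definition does not
refer to the scanning order. -/
theorem GoodAchievable.of_swap {W : PureMAC X Y ι} {r : ℝ × ℝ}
    (h : GoodAchievable W.swap r.swap) : GoodAchievable W r := by
  intro ε hε δ hδ
  obtain ⟨N, hN⟩ := h ε hε δ hδ
  refine ⟨N, fun n hn => ?_⟩
  obtain ⟨M, L, C, hM, hL, ψ, hψ, hsum⟩ := hN n hn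
  refine ⟨L, M, ⟨C.y, C.x⟩, hL, hM, fun k => ψ k.swap, fun k => hψ _, ?_⟩
  rw [mul_comm (L : ℝ)]
  refine le_of_eq_of_le ?_ hsum
  rw [← (Equiv.prodComm (Fin L) (Fin M)).sum_comp]
  refine Finset.sum_congr rfl fun k _ => ?_
  congr 1
  refine Finset.sum_bij (fun j _ => j.swap) (fun j hj => ?_) (fun i _ j _ h => ?_) (fun j hj => ?_)
    fun j hj => rfl
  · simpa [Prod.swap_inj] using hj
  · exact Prod.swap_injective h
  · exact ⟨j.swap, by
      simp only [Finset.mem_erase, Finset.mem_univ, and_true] at hj ⊢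
      rintro rfl
      exact hj rfl, Prod.swap_swap j⟩

theorem goodAchievable_of_mem_region₁ (W : PureMAC X Y ι) (pX : PMF X) (pY : PMF Y) {r : ℝ × ℝ}
    (hr : r ∈ region₁ W pX pY) : GoodAchievable W r := by
  obtain ⟨h1, h2, h3, h4, h5⟩ := hr
  refine .of_swap (goodAchievable_of_mem_region₂ W.swap pY pX ⟨h2, h1, h4, h3, ?_⟩)
  rw [entB_swap]
  simpa [add_comm] using h5

end Pentagons

/-! ### Time sharing -/

section TimeSharing

variable {X Y ι : Type*} {n₁ n₂ L₁ L₂ M₁ M₂ : ℕ}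

/-- The splitting of pairs of concatenated messages. -/
def pairEquiv (L₁ M₁ L₂ M₂ : ℕ) :
    (Fin L₁ × Fin M₁) × (Fin L₂ × Fin M₂) ≃ Fin (L₁ * L₂) × Fin (M₁ * M₂) :=
  (Equiv.prodProdProdComm _ _ _ _).trans (finProdFinEquiv.prodCongr finProdFinEquiv)

/-- The concatenation of two codes. -/
def Code.append (C₁ : Code X Y n₁ L₁ M₁) (C₂ : Code X Y n₂ L₂ M₂) :
    Code X Y (n₁ + n₂) (L₁ * L₂) (M₁ * M₂) where
  x l := Fin.append (C₁.x (finProdFinEquiv.symm l).1) (C₂.x (finProdFinEquiv.symm l).2)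
  y m := Fin.append (C₁.y (finProdFinEquiv.symm m).1) (C₂.y (finProdFinEquiv.symm m).2)

theorem outputVec_append (W : PureMAC X Y ι) (C₁ : Code X Y n₁ L₁ M₁) (C₂ : Code X Y n₂ L₂ M₂)
    (k : (Fin L₁ × Fin M₁) × (Fin L₂ × Fin M₂)) :
    outputVec W (C₁.append C₂) (pairEquiv L₁ M₁ L₂ M₂ k) =
      tens (Fin.appendEquiv n₁ n₂) (outputVec W C₁ k.1) (outputVec W C₂ k.2) := by
  refine slice_ext (Fin.appendEquiv n₁ n₂) fun t => lp.ext (funext fun s => ?_)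
  have h₁ : finProdFinEquiv.symm (pairEquiv L₁ M₁ L₂ M₂ k).1 = (k.1.1, k.2.1) :=
    Equiv.symm_apply_apply _ _
  have h₂ : finProdFinEquiv.symm (pairEquiv L₁ M₁ L₂ M₂ k).2 = (k.1.2, k.2.2) :=
    Equiv.symm_apply_apply _ _
  rw [slice_tens, slice_apply]
  simp [-finProdFinEquiv_symm_apply, outputVec, tensorVec_apply, Code.append, h₁, h₂,
    Fin.prod_univ_add, Fin.appendEquiv, mul_comm]

theorem norm_tens_sub_tens_sq_le {α τ κ : Type*} (e : α × τ ≃ κ) {v v' : Hilb α} {w w' : Hilb τ}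
    (hw : ‖w‖ ≤ 1) (hv' : ‖v'‖ ≤ 1) :
    ‖tens e v w - tens e v' w'‖ ^ 2 ≤ 2 * (‖v - v'‖ ^ 2 + ‖w - w'‖ ^ 2) := by
  have h1 : tens e v w - tens e v' w' = tens e (v - v') w + tens e v' (w - w') := by
    rw [tens_sub_left, tens_sub_right]
    abel
  have h2 : ‖tens e v w - tens e v' w'‖ ≤ ‖v - v'‖ + ‖w - w'‖ := by
    rw [h1]
    refine (norm_add_le _ _).trans (add_le_add ?_ ?_)
    · rw [norm_tens]
      exact mul_le_of_le_one_right (norm_nonneg _) hw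
    · rw [norm_tens]
      exact mul_le_of_le_one_left (norm_nonneg _) hv'
  have := pow_le_pow_left₀ (norm_nonneg _) h2 2
  nlinarith [sq_nonneg (‖v - v'‖ - ‖w - w'‖)]

/-- Concatenation of good codes. The overlaps of distinct pairs of the concatenated code are
products of overlaps of which at least one factor belongs to distinct pairs. -/
theorem GoodCode.append {W : PureMAC X Y ι} {C₁ : Code X Y n₁ L₁ M₁} {C₂ : Code X Y n₂ L₂ M₂}
    {ε₁ ε₂ : ℝ} (h₁ : GoodCode W C₁ ε₁) (h₂ : GoodCode W C₂ ε₂) :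
    GoodCode W (C₁.append C₂) (2 * ε₁ + 2 * ε₂ + ε₁ * ε₂) := by
  obtain ⟨ψ₁, hψ₁, hs₁⟩ := h₁
  obtain ⟨ψ₂, hψ₂, hs₂⟩ := h₂
  -- `d` are the squared distances to the auxiliary vectors, `o` the squared overlaps, and `s` the
  -- sums of the overlaps of distinct pairs.
  set E := pairEquiv L₁ M₁ L₂ M₂ with hE
  set e : (Fin n₁ → ι) × (Fin n₂ → ι) ≃ (Fin (n₁ + n₂) → ι) := Fin.appendEquiv n₁ n₂ with he
  set d₁ := fun k => ‖outputVec W C₁ k - ψ₁ k‖ ^ 2 with hd₁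
  set d₂ := fun k => ‖outputVec W C₂ k - ψ₂ k‖ ^ 2 with hd₂
  set o₁ := fun j k => ‖⟪outputVec W C₁ j, ψ₁ k⟫_ℂ‖ ^ 2 with ho₁
  set o₂ := fun j k => ‖⟪outputVec W C₂ j, ψ₂ k⟫_ℂ‖ ^ 2 with ho₂
  set s₁ := fun k => ∑ j ∈ Finset.univ.erase k, o₁ j k with hs₁'
  set s₂ := fun k => ∑ j ∈ Finset.univ.erase k, o₂ j k with hs₂'
  have hd₁0 : ∀ k, 0 ≤ d₁ k := fun k => sq_nonneg _
  have hd₂0 : ∀ k, 0 ≤ d₂ k := fun k => sq_nonneg _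
  have hs₁0 : ∀ k, 0 ≤ s₁ k := fun k => Finset.sum_nonneg fun j _ => sq_nonneg _
  have hs₂0 : ∀ k, 0 ≤ s₂ k := fun k => Finset.sum_nonneg fun j _ => sq_nonneg _
  have ho₁1 : ∀ k, o₁ k k ≤ 1 := fun k => by
    refine pow_le_one₀ (norm_nonneg _) ((norm_inner_le_norm _ _).trans ?_)
    rw [norm_outputVec, one_mul]
    exact hψ₁ k
  have ho₂1 : ∀ k, o₂ k k ≤ 1 := fun k => by
    refine pow_le_one₀ (norm_nonneg _) ((norm_inner_le_norm _ _).trans ?_)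
    rw [norm_outputVec, one_mul]
    exact hψ₂ k
  have hk : ∀ k, (‖outputVec W (C₁.append C₂) (E k) - tens e (ψ₁ k.1) (ψ₂ k.2)‖ ^ 2 +
      ∑ j ∈ Finset.univ.erase (E k),
        ‖⟪outputVec W (C₁.append C₂) j, tens e (ψ₁ k.1) (ψ₂ k.2)⟫_ℂ‖ ^ 2) ≤
      2 * (d₁ k.1 + d₂ k.2) + (s₁ k.1 * s₂ k.2 + s₁ k.1 + s₂ k.2) := by
    intro k
    refine add_le_add ?_ ?_
    · rw [outputVec_append]
      exact norm_tens_sub_tens_sq_le e (norm_outputVec W C₂ _).le (hψ₁ _)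
    · have h3 : ∀ j, ‖⟪outputVec W (C₁.append C₂) (E j), tens e (ψ₁ k.1) (ψ₂ k.2)⟫_ℂ‖ ^ 2 =
          o₁ j.1 k.1 * o₂ j.2 k.2 := fun j => by
        rw [outputVec_append, inner_tens_tens, norm_mul, mul_pow]
      have h4 := Finset.add_sum_erase Finset.univ (fun j =>
        ‖⟪outputVec W (C₁.append C₂) j, tens e (ψ₁ k.1) (ψ₂ k.2)⟫_ℂ‖ ^ 2) (Finset.mem_univ (E k))
      -- The sum of the overlaps with all pairs is a product; the equal pair is then split off.
      rw [← E.sum_comp] at h4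
      simp only [h3] at h4
      rw [Fintype.sum_prod_type] at h4
      simp only [] at h4
      rw [← Finset.sum_mul_sum] at h4
      have h5 := Finset.add_sum_erase Finset.univ (fun j => o₁ j k.1) (Finset.mem_univ k.1)
      have h6 := Finset.add_sum_erase Finset.univ (fun j => o₂ j k.2) (Finset.mem_univ k.2)
      rw [← h5, ← h6] at h4
      have h7 := mul_le_mul_of_nonneg_right (ho₁1 k.1) (hs₂0 k.2)
      have h8 := mul_le_mul_of_nonneg_left (ho₂1 k.2) (hs₁0 k.1)
      simp only [hs₁', hs₂'] at h7 h8 ⊢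
      linarith
  refine ⟨fun k => tens e (ψ₁ (E.symm k).1) (ψ₂ (E.symm k).2), fun k => ?_, ?_⟩
  · rw [norm_tens]
    exact mul_le_one₀ (hψ₁ _) (norm_nonneg _) (hψ₂ _)
  rw [← E.sum_comp]
  simp only [Equiv.symm_apply_apply]
  refine (Finset.sum_le_sum fun k _ => hk k).trans ?_
  have hsum : ∑ k : (Fin L₁ × Fin M₁) × (Fin L₂ × Fin M₂),
      (2 * (d₁ k.1 + d₂ k.2) + (s₁ k.1 * s₂ k.2 + s₁ k.1 + s₂ k.2)) =
      (L₂ * M₂) * (2 * ∑ k, d₁ k + ∑ k, s₁ k) + (L₁ * M₁) * (2 * ∑ k, d₂ k + ∑ k, s₂ k) +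
        (∑ k, s₁ k) * ∑ k, s₂ k := by
    rw [Finset.sum_mul_sum, Fintype.sum_prod_type]
    simp only [Finset.sum_add_distrib, ← Finset.mul_sum, Finset.sum_const, Finset.card_univ,
      Fintype.card_prod, Fintype.card_fin, nsmul_eq_mul]
    push_cast
    ring
  rw [hsum]
  change ∑ k, (d₁ k + s₁ k) ≤ L₁ * M₁ * ε₁ at hs₁
  change ∑ k, (d₂ k + s₂ k) ≤ L₂ * M₂ * ε₂ at hs₂
  rw [Finset.sum_add_distrib] at hs₁ hs₂
  have h1 : 0 ≤ ∑ k, d₁ k := Finset.sum_nonneg fun k _ => hd₁0 k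
  have h2 : 0 ≤ ∑ k, d₂ k := Finset.sum_nonneg fun k _ => hd₂0 k
  have h3 : 0 ≤ ∑ k, s₁ k := Finset.sum_nonneg fun k _ => hs₁0 k
  have h4 : 0 ≤ ∑ k, s₂ k := Finset.sum_nonneg fun k _ => hs₂0 k
  have hN₁ : (0 : ℝ) ≤ L₁ * M₁ := by positivity
  have hN₂ : (0 : ℝ) ≤ L₂ * M₂ := by positivity
  have h5 : (∑ k, s₁ k) * ∑ k, s₂ k ≤ (L₁ * M₁ * ε₁) * (L₂ * M₂ * ε₂) :=
    mul_le_mul (by linarith) (by linarith) h4 (by linarith)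
  have h6 := mul_le_mul_of_nonneg_left
    (by linarith : 2 * ∑ k, d₁ k + ∑ k, s₁ k ≤ 2 * (L₁ * M₁ * ε₁)) hN₂
  have h7 := mul_le_mul_of_nonneg_left
    (by linarith : 2 * ∑ k, d₂ k + ∑ k, s₂ k ≤ 2 * (L₂ * M₂ * ε₂)) hN₁
  push_cast
  nlinarith

theorem two_rpow_le_mul {u v w a b : ℝ} (h : w ≤ u + v) (ha : (2 : ℝ) ^ u ≤ a)
    (hb : (2 : ℝ) ^ v ≤ b) : (2 : ℝ) ^ w ≤ a * b := by
  calc (2 : ℝ) ^ w ≤ 2 ^ (u + v) := Real.rpow_le_rpow_of_exponent_le one_le_two h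
    _ = 2 ^ u * 2 ^ v := Real.rpow_add two_pos _ _
    _ ≤ a * b := mul_le_mul ha hb (by positivity) (le_trans (by positivity) ha)

/-- Time sharing: a fraction `s` of the channel uses is given to codes for the rate pair `a`, the
rest to codes for `b`. -/
theorem GoodAchievable.convex_combination {W : PureMAC X Y ι} {a b : ℝ × ℝ} (ha1 : 0 ≤ a.1)
    (ha2 : 0 ≤ a.2) (ha : GoodAchievable W a) (hb1 : 0 ≤ b.1) (hb2 : 0 ≤ b.2)
    (hb : GoodAchievable W b) {s t : ℝ} (hs : 0 < s) (ht : 0 < t) (hst : s + t = 1) :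
    GoodAchievable W (s • a + t • b) := by
  intro ε hε δ hδ
  -- For defects at most `ε' ≤ 1`, the concatenated code has defect at most `5 ε'`.
  set ε' := min 1 (ε / 5) with hε'
  have hε'0 : 0 < ε' := lt_min one_pos (by positivity)
  obtain ⟨N₁, hN₁⟩ := ha ε' hε'0 (δ / 2) (by positivity)
  obtain ⟨N₂, hN₂⟩ := hb ε' hε'0 (δ / 2) (by positivity)
  obtain ⟨N, hN⟩ := exists_nat_ge
    (max (max ((N₁ + 1) / s) (N₂ / t)) (max (2 * a.1 / δ) (2 * a.2 / δ)))
  simp only [max_le_iff] at hN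
  obtain ⟨⟨hNa, hNb⟩, hNc, hNd⟩ := hN
  refine ⟨N, fun n hn => ?_⟩
  have hnN : (N : ℝ) ≤ n := by exact_mod_cast hn
  have hn0 : (0 : ℝ) ≤ n := n.cast_nonneg
  obtain ⟨n₁, n₂, hn12, hlow₁, hlow₂⟩ : ∃ n₁ n₂ : ℕ, n₁ + n₂ = n ∧ s * n - 1 ≤ n₁ ∧ t * n ≤ n₂ := by
    have h1 : (⌊s * n⌋₊ : ℝ) ≤ s * n := Nat.floor_le (by positivity)
    have h2 : ⌊s * n⌋₊ ≤ n := by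
      have : (⌊s * n⌋₊ : ℝ) ≤ n := by nlinarith
      exact_mod_cast this
    refine ⟨⌊s * n⌋₊, n - ⌊s * n⌋₊, by omega, (Nat.sub_one_lt_floor _).le, ?_⟩
    rw [Nat.cast_sub h2]
    have : t * n = n - s * n := by
      rw [show t = 1 - s by linarith]
      ring
    linarith
  have hge₁ : N₁ ≤ n₁ := by
    rw [div_le_iff₀ hs] at hNa
    have : (N₁ : ℝ) ≤ n₁ := by nlinarith
    exact_mod_cast this
  have hge₂ : N₂ ≤ n₂ := by
    rw [div_le_iff₀ ht] at hNb
    have : (N₂ : ℝ) ≤ n₂ := by nlinarith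
    exact_mod_cast this
  obtain ⟨L₁, M₁, C₁, hL₁, hM₁, hC₁⟩ := hN₁ n₁ hge₁
  obtain ⟨L₂, M₂, C₂, hL₂, hM₂, hC₂⟩ := hN₂ n₂ hge₂
  -- Rounding `s n` down loses at most one use of the first code, of rate at most `n δ / 2`.
  have hrate : ∀ x y : ℝ, 0 ≤ x → 0 ≤ y → 2 * x / δ ≤ N →
      n * (s * x + t * y - δ) ≤ n₁ * (x - δ / 2) + n₂ * (y - δ / 2) := by
    intro x y hx hy hxN
    rw [div_le_iff₀ hδ] at hxN
    have e : (n₁ : ℝ) + n₂ = n := by exact_mod_cast hn12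
    have h1 := mul_le_mul_of_nonneg_right hlow₁ hx
    have h2 := mul_le_mul_of_nonneg_right hlow₂ hy
    have h3 := mul_le_mul_of_nonneg_right hnN hδ.le
    have h4 : (n₁ : ℝ) * (δ / 2) + n₂ * (δ / 2) = n * (δ / 2) := by rw [← add_mul, e]
    nlinarith
  have h1 := hrate a.1 b.1 ha1 hb1 hNc
  have h2 := hrate a.2 b.2 ha2 hb2 hNd
  subst hn12
  refine ⟨L₁ * L₂, M₁ * M₂, C₁.append C₂, ?_, ?_, ?_⟩
  · rw [Nat.cast_mul]
    exact two_rpow_le_mul h1 hL₁ hL₂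
  · rw [Nat.cast_mul]
    exact two_rpow_le_mul h2 hM₁ hM₂
  · obtain ⟨ψ, hψ, hsum⟩ := hC₁.append hC₂
    refine ⟨ψ, hψ, hsum.trans (mul_le_mul_of_nonneg_left ?_ (by positivity))⟩
    have h3 : ε' ≤ 1 := min_le_left _ _
    have h4 : ε' ≤ ε / 5 := min_le_right _ _
    nlinarith

theorem convex_goodAchievable (W : PureMAC X Y ι) :
    Convex ℝ {r : ℝ × ℝ | 0 ≤ r.1 ∧ 0 ≤ r.2 ∧ GoodAchievable W r} := by
  rw [convex_iff_forall_pos]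
  rintro a ⟨ha1, ha2, ha⟩ b ⟨hb1, hb2, hb⟩ s t hs ht hst
  refine ⟨?_, ?_, ha.convex_combination ha1 ha2 hb1 hb2 hb hs ht hst⟩
  · exact add_nonneg (mul_nonneg hs.le ha1) (mul_nonneg ht.le hb1)
  · exact add_nonneg (mul_nonneg hs.le ha2) (mul_nonneg ht.le hb2)

end TimeSharing

/-! ### Convex geometry of the rate regions -/

section Geometry

theorem convex_setOf_ofReal_le (f : ℝ × ℝ →ₗ[ℝ] ℝ) (a : ℝ≥0∞) :
    Convex ℝ {r : ℝ × ℝ | ENNReal.ofReal (f r) ≤ a} := by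
  have h : IsLowerSet {x : ℝ | ENNReal.ofReal x ≤ a} := fun x y hyx hx =>
    (ENNReal.ofReal_le_ofReal hyx).trans hx
  exact h.ordConnected.convex.linear_preimage f

theorem convex_pentagon (a b c : ℝ≥0∞) : Convex ℝ (pentagon a b c) := by
  have h1 : Convex ℝ {r : ℝ × ℝ | 0 ≤ r.1} := convex_halfSpace_ge (LinearMap.fst ℝ ℝ ℝ).isLinear 0
  have h2 : Convex ℝ {r : ℝ × ℝ | 0 ≤ r.2} := convex_halfSpace_ge (LinearMap.snd ℝ ℝ ℝ).isLinear 0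
  exact h1.inter (h2.inter ((convex_setOf_ofReal_le (LinearMap.fst ℝ ℝ ℝ) a).inter
    ((convex_setOf_ofReal_le (LinearMap.snd ℝ ℝ ℝ) b).inter
      (convex_setOf_ofReal_le (LinearMap.fst ℝ ℝ ℝ + LinearMap.snd ℝ ℝ ℝ) c))))

/-- Two pentagons that are cut off from `pentagon a b c` no lower than its corners
`(c - b, b)` and `(a, c - a)` span it: a point outside both lies on a segment of direction
`(1, -1)` between points of the two. -/
theorem convexHull_pentagon_union {a b a' b' c : ℝ≥0∞} (ha : a' ≤ a) (hb : b' ≤ b) (hc : c ≠ ∞)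
    (h₁ : c - b ≤ a') (h₂ : c - a ≤ b') :
    convexHull ℝ (pentagon a' b c ∪ pentagon a b' c) = pentagon a b c := by
  refine Set.Subset.antisymm (convexHull_min (Set.union_subset ?_ ?_) (convex_pentagon a b c)) ?_
  · rintro r ⟨h1, h2, h3, h4, h5⟩
    exact ⟨h1, h2, h3.trans ha, h4, h5⟩
  · rintro r ⟨h1, h2, h3, h4, h5⟩
    exact ⟨h1, h2, h3, h4.trans hb, h5⟩
  rintro r ⟨h1, h2, h3, h4, h5⟩
  have e₁ : ENNReal.ofReal (c - b).toReal = c - b := ENNReal.ofReal_toReal (by finiteness)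
  have e₂ : ENNReal.ofReal (c - a).toReal = c - a := ENNReal.ofReal_toReal (by finiteness)
  have hx0 : 0 ≤ (c - b).toReal := ENNReal.toReal_nonneg
  have hy0 : 0 ≤ (c - a).toReal := ENNReal.toReal_nonneg
  set x := (c - b).toReal
  set y := (c - a).toReal
  rcases le_or_gt r.1 x with hx | hx
  · exact subset_convexHull ℝ _ (Or.inl
      ⟨h1, h2, (ENNReal.ofReal_le_ofReal hx).trans (e₁.trans_le h₁), h4, h5⟩)
  rcases le_or_gt r.2 y with hy | hy
  · exact subset_convexHull ℝ _ (Or.inr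
      ⟨h1, h2, h3, (ENNReal.ofReal_le_ofReal hy).trans (e₂.trans_le h₂), h5⟩)
  -- The line of slope `-1` through `r` meets the two pentagons at `r.1 = x` and at `r.2 = y`.
  have hP : (x, r.1 + r.2 - x) ∈ pentagon a' b c := by
    refine ⟨hx0, by simp only; linarith, e₁.trans_le h₁, ?_, by simpa using h5⟩
    simp only
    rw [ENNReal.ofReal_sub _ hx0, e₁]
    exact (tsub_le_tsub_right h5 _).trans tsub_tsub_le
  have hQ : (r.1 + r.2 - y, y) ∈ pentagon a b' c := by
    refine ⟨by simp only; linarith, hy0, ?_, e₂.trans_le h₂, by simpa using h5⟩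
    simp only
    rw [ENNReal.ofReal_sub _ hy0, e₂]
    exact (tsub_le_tsub_right h5 _).trans tsub_tsub_le
  have hD : 0 < r.1 + r.2 - y - x := by linarith
  have hcomb : r = ((r.2 - y) / (r.1 + r.2 - y - x)) • (x, r.1 + r.2 - x) +
      ((r.1 - x) / (r.1 + r.2 - y - x)) • (r.1 + r.2 - y, y) := by
    have hD' := hD.ne'
    ext
    · simp
      field_simp
      ring
    · simp
      field_simp
      ring
  have hP' := subset_convexHull ℝ (pentagon a' b c ∪ pentagon a b' c) (Or.inl hP)
  have hQ' := subset_convexHull ℝ (pentagon a' b c ∪ pentagon a b' c) (Or.inr hQ)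
  rw [hcomb]
  refine convex_convexHull ℝ _ hP' hQ' (div_nonneg (by linarith) hD.le)
    (div_nonneg (by linarith) hD.le) ?_
  rw [← add_div, div_eq_one_iff_eq hD.ne']
  ring

end Geometry

end SeqMAC

end

theorem mainTheorem2 {X Y ι : Type*} (W : SeqMAC.PureMAC X Y ι) (pX : PMF X) (pY : PMF Y) :
    (∀ r ∈ SeqMAC.region₂ W pX pY, SeqMAC.SeqAchievable W r) ∧
    (∀ r ∈ convexHull ℝ (SeqMAC.region₁ W pX pY ∪ SeqMAC.region₂ W pX pY),
      SeqMAC.SeqAchievable W r) ∧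
    (SeqMAC.entB W pX pY ≠ ⊤ →
      (min (ENNReal.ofReal (SeqMAC.minEntBY W pX)) (SeqMAC.infoXB W pX pY),
          SeqMAC.entBX W pX pY) =
        (SeqMAC.infoXB W pX pY, SeqMAC.entBX W pX pY) →
      (SeqMAC.entBY W pX pY,
          min (ENNReal.ofReal (SeqMAC.minEntBX W pY)) (SeqMAC.infoYB W pX pY)) =
        (SeqMAC.entBY W pX pY, SeqMAC.infoYB W pX pY) →
      convexHull ℝ (SeqMAC.region₁ W pX pY ∪ SeqMAC.region₂ W pX pY) =
        SeqMAC.fullRegion W pX pY) := by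
  refine ⟨fun r hr => (SeqMAC.goodAchievable_of_mem_region₂ W pX pY hr).seqAchievable, ?_, ?_⟩
  · intro r hr
    have hsub : SeqMAC.region₁ W pX pY ∪ SeqMAC.region₂ W pX pY ⊆
        {r : ℝ × ℝ | 0 ≤ r.1 ∧ 0 ≤ r.2 ∧ SeqMAC.GoodAchievable W r} := by
      rintro r (h | h)
      · exact ⟨h.1, h.2.1, SeqMAC.goodAchievable_of_mem_region₁ W pX pY h⟩
      · exact ⟨h.1, h.2.1, SeqMAC.goodAchievable_of_mem_region₂ W pX pY h⟩
    exact (convexHull_min hsub (SeqMAC.convex_goodAchievable W) hr).2.2.seqAchievable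
  · intro hB h₁ h₂
    exact SeqMAC.convexHull_pentagon_union
      (SeqMAC.ofReal_condMinEntropy_le pX pY fun y x => W.norm_φ x y)
      (SeqMAC.ofReal_condMinEntropy_le pY pX fun x y => W.norm_φ x y) hB
      (min_eq_right_iff.1 (Prod.ext_iff.1 h₁).1) (min_eq_right_iff.1 (Prod.ext_iff.1 h₂).2)
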